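/- Let $M$ be a compact connected smooth Riemannian manifold without boundary, with Riemannian distance $d$, and let $f:M\to M$ be a $C^2$ map that is non-degenerate ($D_xf$ is invertible for every $x\in M$). Let $M^f=\{\tilde x=(x_i)_{i\in\mathbb Z}\in M^{\mathbb Z} : f(x_i)=x_{i+1}\text{ for all } i\in\mathbb Z\}$ with the metric $\tilde d(\tilde x,\tilde y)=\sum_{n\in\mathbb Z}2^{-|n|}d(x_n,y_n)$, the left shift $\tau:M^f\to M^f$, and the projection $\Pi(\tilde x)=x_0$. Suppose that $f$ is a partially hyperbolic endomorphism with one-dimensional center bundle: there are a continuous splitting $T_{x_0}M=E^s(\tilde x)\oplus E^c(\tilde x)\oplus E^u(\tilde x)$, $\tilde x\in M^f$, of the pull-back bundle $\Pi^*TM$ with $\dim E^c(\tilde x)=1$, and constants $C>0$, $0<\lambda_s<1<\lambda_u$, $\lambda_s<\lambda_1\le\lambda_2<\lambda_u$, such that for every $\tilde x\in M^f$ 1. $D_{x_0}f(E^t(\tilde x))=E^t(\tau\tilde x)$ for $t\in\{s,c,u\}$; 2. $\|D_{x_0}f^n v\|\le C\lambda_s^n\|v\|$ for $v\in E^s(\tilde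 x)$, $n\ge 0$; 3. $C^{-1}\lambda_1^n\|v\|\le\|D_{x_0}f^n v\|\le C\lambda_2^n\|v\|$ for $v\in E^c(\tilde x)$, $n\ge 0$; 4. $\|D_{x_0}f^n v\|\ge C^{-1}\lambda_u^n\|v\|$ for $v\in E^u(\tilde x)$, $n\ge 0$. Put $\tilde\varphi^c(\tilde x)=\log\|D_{x_0}f|_{E^c(\tilde x)}\|$ and, for $r>0$, let $$\tilde{\mathcal G}=\Big\{(\tilde x,n)\in M^f\times\mathbb N : \sum_{i=0}^{j-1}\tilde\varphi^c(\tau^i\tilde x)<-rj \text{ for all } 1\le j\le n\Big\}.$$ Then for every $r>0$ and every Hölder continuous function $\phi:M\to\mathbb R$ there exists $\tilde\varepsilon>0$ such that for every $0<\varepsilon<\tilde\varepsilon$ the function $\phi^*=\phi\circ\Pi$ has the Bowen property on $\tilde{\mathcal G}$ at scale $\varepsilon$: there is a constant $K>0$ such that $$\Big|\sum_{i=0}^{n-1}\phi^*(\tau^i\tilde x)-\sum_{i=0}^{n-1}\phi^*(\tau^i\tilde y)\Big|\le K$$ for all $(\tilde x,n)\in\tilde{\mathcal G}$ and all $\tilde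 y\in M^f$ with $\tilde d(\tau^i\tilde x,\tau^i\tilde y)<\varepsilon$ for $0\le i<n$. -/

import Mathlib

open Set Filter Topology Manifold Bundle
open scoped ContDiff NNReal

noncomputable section

namespace PHEndo

/-! ### Bowen balls and the Bowen property -/

/-- The Bowen ball `B_n(x, ε)` of the map `T : X → X` for the distance function `ρ`: the points
`y` with `max_{0 ≤ i < n} ρ (T^i x) (T^i y) < ε`. -/
def bowenBall {X : Type*} (ρ : X → X → ℝ) (T : X → X) (n : ℕ) (x : X) (ε : ℝ) : Set X :=
  {y | ∀ i < n, ρ (T^[i] x) (T^[i] y) < ε}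

/-- `ψ` has the Bowen property at scale `ε` on the collection `𝒞` of orbit segments: there is a
distortion constant `K > 0` with `|∑_{i<n} ψ (T^i x) - ∑_{i<n} ψ (T^i y)| ≤ K` for all
`(x, n) ∈ 𝒞` and all `y ∈ B_n(x, ε)`. -/
def BowenProperty {X : Type*} (ρ : X → X → ℝ) (T : X → X) (ψ : X → ℝ) (𝒞 : Set (X × ℕ))
    (ε : ℝ) : Prop :=
  ∃ K : ℝ, 0 < K ∧ ∀ x n, (x, n) ∈ 𝒞 → ∀ y ∈ bowenBall ρ T n x ε,
    |birkhoffSum T ψ n x - birkhoffSum T ψ n y| ≤ K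

/-! ### The inverse limit space -/

/-- The inverse limit (orbit) space `M^f`: the full orbits `(x_i)_{i ∈ ℤ}`, `f x_i = x_{i+1}`.
It carries the topology induced by the product topology of `M^ℤ`. -/
abbrev InverseLimit {M : Type*} (f : M → M) : Type _ :=
  {x : ℤ → M // ∀ i : ℤ, f (x i) = x (i + 1)}

/-- The natural projection `Π : M^f → M`, `Π (x_i) = x_0`. -/
def proj {M : Type*} (f : M → M) (x : InverseLimit f) : M := x.1 0

/-- The left shift `τ : M^f → M^f`. -/
def shift {M : Type*} (f : M → M) (x : InverseLimit f) : InverseLimit f :=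
  ⟨fun i => x.1 (i + 1), fun i => x.2 (i + 1)⟩

/-- The metric `d̃(x, y) = ∑_{n ∈ ℤ} 2^{-|n|} d(x_n, y_n)` of the inverse limit space. The series
converges as soon as `M` is bounded, in particular when `M` is compact. -/
def orbitDist {M : Type*} [MetricSpace M] (f : M → M) (x y : InverseLimit f) : ℝ :=
  ∑' n : ℤ, (1 / 2 : ℝ) ^ n.natAbs * dist (x.1 n) (y.1 n)

/-! ### Subbundles of the pulled back tangent bundle and partial hyperbolicity -/

section Bundle

variable {E : Type*} [NormedAddCommGroup E] [NormedSpace ℝ E]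
  {M : Type*} [MetricSpace M] [ChartedSpace E M] [IsManifold 𝓘(ℝ, E) ∞ M]

/-- A family of linear subspaces of the fibres `(Π^* TM)(x̃) = T_{x_0} M` of the pull-back of the
tangent bundle under `Π : M^f → M`. -/
abbrev SubspaceFamily (f : M → M) : Type _ :=
  ∀ x : InverseLimit f, Submodule ℝ (TangentSpace 𝓘(ℝ, E) (proj f x))

/-- The family is a continuous subbundle of `Π^* TM`: near every point of `M^f` it is spanned by
finitely many pointwise linearly independent continuous sections of `Π^* TM`. -/
def IsContinuousSubbundle {f : M → M} (V : SubspaceFamily (E := E) f) : Prop :=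
  ∀ x₀ : InverseLimit f, ∃ U ∈ 𝓝 x₀, ∃ (k : ℕ)
    (X : Fin k → ∀ x : InverseLimit f, TangentSpace 𝓘(ℝ, E) (proj f x)),
    (∀ i, ContinuousOn (fun x => (⟨proj f x, X i x⟩ : TangentBundle 𝓘(ℝ, E) M)) U) ∧
    ∀ x ∈ U, LinearIndependent ℝ (fun i => X i x) ∧
      Submodule.span ℝ (Set.range (fun i => X i x)) = V x

/-- The subspace `V x̃`, as a set of vectors of the tangent bundle based at `x_0`. -/
def fiberSet {f : M → M} (V : SubspaceFamily (E := E) f) (x : InverseLimit f) :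
    Set (TangentBundle 𝓘(ℝ, E) M) :=
  {p | ∃ v ∈ V x, p = ⟨proj f x, v⟩}

/-- Invariance `D_x̃ f (V x̃) = V (τ x̃)` of the family (stated in the tangent bundle). -/
def IsInvariantFamily {f : M → M} (V : SubspaceFamily (E := E) f) : Prop :=
  ∀ x : InverseLimit f,
    tangentMap 𝓘(ℝ, E) 𝓘(ℝ, E) f '' fiberSet V x = fiberSet V (shift f x)

/-- `f` is non-degenerate: all its derivatives are invertible. -/
def NonDegenerate (f : M → M) : Prop :=
  ∀ p : M, Function.Bijective (mfderiv 𝓘(ℝ, E) 𝓘(ℝ, E) f p)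

variable [RiemannianBundle (fun p : M => TangentSpace 𝓘(ℝ, E) p)]

/-- `Π^* TM = E^s ⊕ E^c ⊕ E^u` is a partially hyperbolic splitting for `f`. -/
structure IsPartiallyHyperbolicSplitting (f : M → M) (Es Ec Eu : SubspaceFamily (E := E) f) :
    Prop where
  continuous_s : IsContinuousSubbundle Es
  continuous_c : IsContinuousSubbundle Ec
  continuous_u : IsContinuousSubbundle Eu
  /-- together with the next field: `T_{x_0} M` is the internal direct sum of the three. -/
  disjoint_sc : ∀ x, Disjoint (Es x) (Ec x)
  isCompl_scu : ∀ x, IsCompl (Es x ⊔ Ec x) (Eu x)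
  invariant_s : IsInvariantFamily Es
  invariant_c : IsInvariantFamily Ec
  invariant_u : IsInvariantFamily Eu
  rates : ∃ ls l₁ l₂ lu C : ℝ,
    0 < ls ∧ ls < 1 ∧ 1 < lu ∧ ls < l₁ ∧ l₁ ≤ l₂ ∧ l₂ < lu ∧ 0 < C ∧
    ∀ (x : InverseLimit f) (n : ℕ),
      (∀ v ∈ Es x, ‖mfderiv 𝓘(ℝ, E) 𝓘(ℝ, E) (f^[n]) (proj f x) v‖ ≤ C * ls ^ n * ‖v‖) ∧
      (∀ v ∈ Ec x, C⁻¹ * l₁ ^ n * ‖v‖ ≤ ‖mfderiv 𝓘(ℝ, E) 𝓘(ℝ, E) (f^[n]) (proj f x) v‖ ∧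
        ‖mfderiv 𝓘(ℝ, E) 𝓘(ℝ, E) (f^[n]) (proj f x) v‖ ≤ C * l₂ ^ n * ‖v‖) ∧
      (∀ v ∈ Eu x, C⁻¹ * lu ^ n * ‖v‖ ≤ ‖mfderiv 𝓘(ℝ, E) 𝓘(ℝ, E) (f^[n]) (proj f x) v‖)

/-- `φ̃^c(x̃) = log ‖Df|_{E^c(x̃)}‖`, with the operator norm of the Riemannian norms. -/
def centralLog {f : M → M} (Ec : SubspaceFamily (E := E) f) (x : InverseLimit f) : ℝ :=
  Real.log ‖(mfderiv 𝓘(ℝ, E) 𝓘(ℝ, E) f (proj f x)).comp (Ec x).subtypeL‖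

/-- The good collection `𝒢̃`: the orbit segments `(x̃, n)` of `τ` with
`∑_{i<j} φ̃^c(τ^i x̃) < - r j` for all `1 ≤ j ≤ n`. -/
def goodCollection {f : M → M} (Ec : SubspaceFamily (E := E) f) (r : ℝ) :
    Set (InverseLimit f × ℕ) :=
  {p | ∀ j : ℕ, 1 ≤ j → j ≤ p.2 →
    birkhoffSum (shift f) (centralLog Ec) j p.1 < -r * (j : ℝ)}

end Bundle

end PHEndo

end

/-!
The function `φ` is Hölder, so it is enough to bound `d (x_i, y_i)`, for `0 ≤ i ≤ m = n - 1`, by a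
constant multiple of `ρ ^ i + ρ ^ (m - i)` with `ρ < 1`.

*From distances to tangent vectors.* A smooth embedding `e` of `M` in a Euclidean space turns close
points `x`, `y` into a vector `V x y ∈ T_x M` of length comparable to `d (x, y)`, chosen so that
`D e` maps it to `e y - e x` and `D (e ∘ f)` maps it to `e (f y) - e (f x)`, up to an error that is
small compared to `d (x, y)`. Hence `v_i = V x_i y_i` satisfies
`‖v_{i+1} - D f v_i‖ ≤ η ‖v_i‖` (`PHEndo.exists_displacement`). In particular no exponential map and
no invariant foliation is used, and only the splitting along the orbit of `x` plays a role.

*Linear estimate.* The angles between the three subspaces are bounded below by the rates alone, so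
`v` can be decomposed into components along `E^s`, `E^c`, `E^u`, each with its own error terms. The
stable and center components are computed from their initial values, the unstable one is pulled
back from its final value. Let `A_j` be the growth of `D f^j` on the center line at `x_0`; it is at
most `e ^ (-r j)` on the good collection. The errors are absorbed by the weight
`A_j κ ^ j + μ ^ (-(m - j))`, with `κ > 1` close to one and `max (λ₂, 1) < μ < λ_u`: an error made
at time `k` in the center direction need not be contracted between times `k` and `j`, but it is at
most `η ‖v_k‖`, and it either inherits the decay `A_k κ ^ k` or is dominated by the growth of the
unstable component. So a bound of `v` by `Q` times the weight improves to `H (1 + η Q)` times the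
weight (`PHEndo.IsPartiallyHyperbolicCocycle.exists_bootstrap`), and the optimal `Q` is at most
`2 H` for small `η` (`PHEndo.IsPartiallyHyperbolicCocycle.exists_approximate_orbit_bound`).
-/

noncomputable section

namespace PHEndo

/-! ### Derivatives in charts -/

section Geometry

variable {E : Type*} [NormedAddCommGroup E] [NormedSpace ℝ E]
  {M : Type*} [MetricSpace M] [ChartedSpace E M]
  {W W' : Type*} [NormedAddCommGroup W] [NormedSpace ℝ W]
  [NormedAddCommGroup W'] [NormedSpace ℝ W']

variable (E) in
/-- The derivative at `x` of a vector valued function on `M`. The tangent space `T_x M` is replaced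
by the model space `E` that underlies it, so that the type does not depend on `x`. -/
def vecDeriv (F : M → W) (x : M) : E →L[ℝ] W := mfderiv 𝓘(ℝ, E) 𝓘(ℝ, W) F x

variable (E) in
/-- The derivative at `x` of a self-map of `M`, as an endomorphism of the model space `E` that
underlies both `T_x M` and `T_{f x} M`. -/
def tanDeriv (f : M → M) (x : M) : E →L[ℝ] E := mfderiv 𝓘(ℝ, E) 𝓘(ℝ, E) f x

theorem vecDeriv_comp {F : M → W} {f : M → M} {x : M}
    (hf : MDifferentiableAt 𝓘(ℝ, E) 𝓘(ℝ, E) f x)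
    (hF : MDifferentiableAt 𝓘(ℝ, E) 𝓘(ℝ, W) F (f x)) :
    vecDeriv E (F ∘ f) x = (vecDeriv E F (f x)).comp (tanDeriv E f x) :=
  mfderiv_comp x hF hf

theorem tanDeriv_comp {g f : M → M} {x : M}
    (hf : MDifferentiableAt 𝓘(ℝ, E) 𝓘(ℝ, E) f x)
    (hg : MDifferentiableAt 𝓘(ℝ, E) 𝓘(ℝ, E) g (f x)) :
    tanDeriv E (g ∘ f) x = (tanDeriv E g (f x)).comp (tanDeriv E f x) :=
  mfderiv_comp x hg hf

theorem vecDeriv_clm_comp (T : W →L[ℝ] W') {F : M → W} {x : M}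
    (hF : MDifferentiableAt 𝓘(ℝ, E) 𝓘(ℝ, W) F x) (v : E) :
    vecDeriv E (T ∘ F) x v = T (vecDeriv E F x v) := by
  have h := mfderiv_comp x (T.mdifferentiableAt (x := F x)) hF
  rw [T.mfderiv_eq] at h
  exact congr($h v)

theorem vecDeriv_prodMk {F : M → W} {G : M → W'} {x : M}
    (hF : MDifferentiableAt 𝓘(ℝ, E) 𝓘(ℝ, W) F x) (hG : MDifferentiableAt 𝓘(ℝ, E) 𝓘(ℝ, W') G x)
    (v : E) : vecDeriv E (fun x => (F x, G x)) x v = (vecDeriv E F x v, vecDeriv E G x v) := by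
  have h := hF.prodMk_space hG
  exact Prod.ext (vecDeriv_clm_comp (ContinuousLinearMap.fst ℝ W W') h v).symm
    (vecDeriv_clm_comp (ContinuousLinearMap.snd ℝ W W') h v).symm

variable (E) in
/-- The derivative of the inverse of the chart at `x₀`, at the coordinates of `x`. -/
def chartSymmDeriv (x₀ x : M) : E →L[ℝ] E :=
  mfderivWithin 𝓘(ℝ, E) 𝓘(ℝ, E) (extChartAt 𝓘(ℝ, E) x₀).symm (range 𝓘(ℝ, E))
    (extChartAt 𝓘(ℝ, E) x₀ x)

theorem contDiffAt_comp_extChartAt_symm {F : M → W} (hF : ContMDiff 𝓘(ℝ, E) 𝓘(ℝ, W) 1 F)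
    (x₀ : M) : ContDiffAt ℝ 1 (F ∘ (extChartAt 𝓘(ℝ, E) x₀).symm) (extChartAt 𝓘(ℝ, E) x₀ x₀) := by
  have h := (contMDiffAt_iff.1 (hF x₀)).2
  rw [extChartAt_model_space_eq_id] at h
  simpa [contDiffWithinAt_univ, Function.comp_def] using h

variable [IsManifold 𝓘(ℝ, E) ∞ M]

/-- Along the chart at `x₀`, the derivative of `F` is the derivative of its coordinate
expression. -/
theorem vecDeriv_chartSymmDeriv {F : M → W} {x₀ x : M}
    (hx : x ∈ (extChartAt 𝓘(ℝ, E) x₀).source)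
    (hF : MDifferentiableAt 𝓘(ℝ, E) 𝓘(ℝ, W) F x) (h : E) :
    vecDeriv E F x (chartSymmDeriv E x₀ x h) =
      fderiv ℝ (F ∘ (extChartAt 𝓘(ℝ, E) x₀).symm) (extChartAt 𝓘(ℝ, E) x₀ x) h := by
  have hx' : (extChartAt 𝓘(ℝ, E) x₀).symm (extChartAt 𝓘(ℝ, E) x₀ x) = x :=
    (extChartAt 𝓘(ℝ, E) x₀).left_inv hx
  have hF' : MDifferentiableAt 𝓘(ℝ, E) 𝓘(ℝ, W) F
      ((extChartAt 𝓘(ℝ, E) x₀).symm (extChartAt 𝓘(ℝ, E) x₀ x)) := by rwa [hx']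
  have key := mfderiv_comp_mfderivWithin (extChartAt 𝓘(ℝ, E) x₀ x) hF'
    (mdifferentiableWithinAt_extChartAt_symm ((extChartAt 𝓘(ℝ, E) x₀).map_source hx))
    (by simpa using uniqueMDiffWithinAt_univ 𝓘(ℝ, E))
  have h1 : fderiv ℝ (F ∘ (extChartAt 𝓘(ℝ, E) x₀).symm) (extChartAt 𝓘(ℝ, E) x₀ x) =
      (vecDeriv E F ((extChartAt 𝓘(ℝ, E) x₀).symm (extChartAt 𝓘(ℝ, E) x₀ x))).comp
        (chartSymmDeriv E x₀ x) := by
    refine Eq.trans ?_ key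
    rw [mfderivWithin_eq_fderivWithin]
    simp
  rw [h1, hx']
  rfl

theorem chartSymmDeriv_vecDeriv_chart {x₀ x : M} (hx : x ∈ (extChartAt 𝓘(ℝ, E) x₀).source) (v : E) :
    chartSymmDeriv E x₀ x (vecDeriv E (extChartAt 𝓘(ℝ, E) x₀) x v) = v := by
  have := mfderivWithin_extChartAt_symm_comp_mfderiv_extChartAt (I := 𝓘(ℝ, E))
    ((extChartAt 𝓘(ℝ, E) x₀).map_source hx)
  rw [(extChartAt 𝓘(ℝ, E) x₀).left_inv hx] at this
  exact congr($this v)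

theorem vecDeriv_chart_chartSymmDeriv {x₀ x : M} (hx : x ∈ (extChartAt 𝓘(ℝ, E) x₀).source)
    (h : E) : vecDeriv E (extChartAt 𝓘(ℝ, E) x₀) x (chartSymmDeriv E x₀ x h) = h := by
  have := mfderiv_extChartAt_comp_mfderivWithin_extChartAt_symm (I := 𝓘(ℝ, E))
    ((extChartAt 𝓘(ℝ, E) x₀).map_source hx)
  rw [(extChartAt 𝓘(ℝ, E) x₀).left_inv hx] at this
  exact congr($this h)

variable [RiemannianBundle (fun p : M => TangentSpace 𝓘(ℝ, E) p)]

variable (E) in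
/-- The Riemannian norm of `T_x M`, as a seminorm on the model space `E` underlying `T_x M`. -/
def tanNorm (x : M) : Seminorm ℝ E := normSeminorm ℝ (TangentSpace 𝓘(ℝ, E) x)

variable [IsContMDiffRiemannianBundle 𝓘(ℝ, E) ∞ E (fun p : M => TangentSpace 𝓘(ℝ, E) p)]

theorem isContinuousRiemannianBundle_tangentSpace :
    IsContinuousRiemannianBundle E (fun p : M => TangentSpace 𝓘(ℝ, E) p) :=
  let ⟨g, hg, hg'⟩ := IsContMDiffRiemannianBundle.exists_contMDiff (IB := 𝓘(ℝ, E)) (n := ∞)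
    (F := E) (E := fun p : M => TangentSpace 𝓘(ℝ, E) p)
  ⟨g, hg.continuous, hg'⟩

-- The tangent spaces of `E` itself carry the norm of `E`.
attribute [local instance] normedAddCommGroupTangentSpaceVectorSpace
  normedSpaceTangentSpaceVectorSpace

theorem eventually_norm_chart_le (x₀ : M) : ∃ C : ℝ, 0 < C ∧ ∀ᶠ x in 𝓝 x₀, ∀ v : E,
    ‖vecDeriv E (extChartAt 𝓘(ℝ, E) x₀) x v‖ ≤ C * tanNorm E x v := by
  have := isContinuousRiemannianBundle_tangentSpace (E := E) (M := M)
  obtain ⟨C, hC, h⟩ := eventually_norm_mfderiv_extChartAt_lt 𝓘(ℝ, E) x₀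
  refine ⟨C, hC, h.mono fun x hx v => ?_⟩
  exact ContinuousLinearMap.le_of_opNorm_le _ hx.le _

theorem eventually_tanNorm_chartSymmDeriv_le (x₀ : M) : ∃ C : ℝ, 0 < C ∧ ∀ᶠ x in 𝓝 x₀, ∀ h : E,
    tanNorm E x (chartSymmDeriv E x₀ x h) ≤ C * ‖h‖ := by
  have := isContinuousRiemannianBundle_tangentSpace (E := E) (M := M)
  obtain ⟨C, hC, h⟩ := eventually_norm_mfderivWithin_symm_extChartAt_comp_lt 𝓘(ℝ, E) x₀
  refine ⟨C, hC, ?_⟩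
  filter_upwards [h, extChartAt_source_mem_nhds (I := 𝓘(ℝ, E)) x₀] with x hx hxs v
  have key : tanNorm E ((extChartAt 𝓘(ℝ, E) x₀).symm (extChartAt 𝓘(ℝ, E) x₀ x))
      (chartSymmDeriv E x₀ x v) ≤ C * ‖v‖ :=
    ContinuousLinearMap.le_of_opNorm_le _ hx.le _
  rwa [(extChartAt 𝓘(ℝ, E) x₀).left_inv hxs] at key

end Geometry

/-! ### Uniform estimates on compact manifolds -/

/-- A bound that holds near every point, with a constant in which it is monotone, holds uniformly
on a compact space. -/
theorem exists_forall_of_forall_eventually {X : Type*} [TopologicalSpace X] [CompactSpace X]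
    {P : ℝ → X → Prop} (hP : ∀ ⦃C C'⦄, C ≤ C' → ∀ x, P C x → P C' x)
    (h : ∀ x₀, ∃ C, ∀ᶠ x in 𝓝 x₀, P C x) : ∃ C : ℝ, 0 < C ∧ ∀ x, P C x := by
  suffices ∃ C : ℝ, ∀ x ∈ (univ : Set X), P C x by
    obtain ⟨C, hC⟩ := this
    exact ⟨max C 1, by positivity, fun x => hP (le_max_left _ _) x (hC x (mem_univ x))⟩
  refine isCompact_univ.induction_on (p := fun s => ∃ C : ℝ, ∀ x ∈ s, P C x) ⟨0, by simp⟩ ?_ ?_ ?_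
  · rintro s t hst ⟨C, hC⟩
    exact ⟨C, fun x hx => hC x (hst hx)⟩
  · rintro s t ⟨C, hC⟩ ⟨C', hC'⟩
    refine ⟨max C C', fun x hx => ?_⟩
    rcases hx with hx | hx
    · exact hP (le_max_left _ _) x (hC x hx)
    · exact hP (le_max_right _ _) x (hC' x hx)
  · intro x _
    obtain ⟨C, hC⟩ := h x
    exact ⟨_, mem_nhdsWithin_of_mem_nhds hC, C, fun y hy => hy⟩

/-- Two-point version of `exists_forall_of_forall_eventually`: the bound holds for all pairs of
sufficiently close points. -/
theorem exists_forall_dist_lt_of_forall_eventually {X : Type*} [MetricSpace X] [CompactSpace X]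
    {P : ℝ → X → X → Prop} (hP : ∀ ⦃C C'⦄, C ≤ C' → ∀ x y, P C x y → P C' x y)
    (h : ∀ x₀, ∃ C, ∀ᶠ z in 𝓝 (x₀, x₀), P C z.1 z.2) :
    ∃ C : ℝ, 0 < C ∧ ∃ ε : ℝ, 0 < ε ∧ ∀ x y, dist x y < ε → P C x y := by
  -- The inverse of the constant serves as radius, so that the one-point statement applies.
  have key : ∀ x₀ : X, ∃ C : ℝ, ∀ᶠ x in 𝓝 x₀, 0 < C ∧ ∀ y, dist x y < C⁻¹ → P C x y := by
    intro x₀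
    obtain ⟨C, hC⟩ := h x₀
    obtain ⟨δ, hδ, hb⟩ := Metric.mem_nhds_iff.1 hC
    refine ⟨max C (2 * δ⁻¹), ?_⟩
    filter_upwards [Metric.ball_mem_nhds x₀ (half_pos hδ)] with x hx
    refine ⟨lt_max_of_lt_right (by positivity), fun y hy => hP (le_max_left _ _) _ _ ?_⟩
    have hy' : dist x y < δ / 2 := by
      refine hy.trans_le ?_
      calc (max C (2 * δ⁻¹))⁻¹ ≤ (2 * δ⁻¹)⁻¹ := by
            gcongr
            exact le_max_right _ _
        _ = δ / 2 := by field_simp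
    have hx' : dist x x₀ < δ / 2 := hx
    have hmem : (x, y) ∈ Metric.ball (x₀, x₀) δ → P C x y := fun hz => hb hz
    refine hmem (Metric.mem_ball.2 ?_)
    rw [Prod.dist_eq]
    refine max_lt (by simpa using by linarith) ?_
    have := dist_triangle_left y x₀ x
    simpa using by linarith
  obtain ⟨C, hC, h'⟩ := exists_forall_of_forall_eventually
    (P := fun C x => 0 < C ∧ ∀ y, dist x y < C⁻¹ → P C x y)
    (fun C C' hCC' x ⟨h0, hx⟩ => ⟨h0.trans_le hCC', fun y hy =>
      hP hCC' _ _ (hx y (hy.trans_le (inv_anti₀ h0 hCC')))⟩) key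
  exact ⟨C, hC, C⁻¹, inv_pos.2 hC, fun x y hxy => (h' x).2 y hxy⟩

/-- A strictly differentiable map with injective derivative is locally expanding up to a
constant. -/
theorem eventually_norm_sub_le_of_injective {E W : Type*} [NormedAddCommGroup E] [NormedSpace ℝ E]
    [FiniteDimensional ℝ E] [NormedAddCommGroup W] [NormedSpace ℝ W] {G : E → W} {a : E}
    (hG : ContDiffAt ℝ 1 G a) (hinj : Function.Injective (fderiv ℝ G a)) :
    ∃ C : ℝ, 0 < C ∧ (∀ᶠ p in 𝓝 (a, a), ‖p.1 - p.2‖ ≤ C * ‖G p.1 - G p.2‖) ∧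
      ∀ᶠ b in 𝓝 a, ∀ h : E, ‖h‖ ≤ C * ‖fderiv ℝ G b h‖ := by
  obtain ⟨K, hK, hK'⟩ := LinearMap.exists_antilipschitzWith (fderiv ℝ G a : E →ₗ[ℝ] W)
    (LinearMap.ker_eq_bot.2 hinj)
  have hK0 : (0 : ℝ) < K := hK
  have hle : ∀ h : E, ‖h‖ ≤ K * ‖fderiv ℝ G a h‖ := fun h => by
    simpa using hK'.le_mul_dist h 0
  refine ⟨2 * K, by positivity, ?_, ?_⟩
  · have hs := (hG.hasStrictFDerivAt one_ne_zero).isLittleO.def (c := (2 * K : ℝ)⁻¹) (by positivity)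
    filter_upwards [hs] with p hp
    have h1 := hle (p.1 - p.2)
    have h2 : ‖fderiv ℝ G a (p.1 - p.2)‖ ≤
        ‖G p.1 - G p.2‖ + (2 * K : ℝ)⁻¹ * ‖p.1 - p.2‖ := by
      have := norm_sub_norm_le (fderiv ℝ G a (p.1 - p.2)) (G p.1 - G p.2)
      rw [norm_sub_rev (fderiv ℝ G a (p.1 - p.2))] at this
      linarith
    have h3 : (K : ℝ) * ((2 * K : ℝ)⁻¹ * ‖p.1 - p.2‖) = ‖p.1 - p.2‖ / 2 := by field_simp
    have h4 := mul_le_mul_of_nonneg_left h2 hK0.le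
    rw [mul_add, h3] at h4
    linarith
  · have hc : ContinuousAt (fderiv ℝ G) a := (hG.fderiv_right (m := 0) (by simp)).continuousAt
    filter_upwards [Metric.continuousAt_iff'.1 hc (2 * K : ℝ)⁻¹ (by positivity)] with b hb h
    rw [dist_eq_norm] at hb
    have h1 := hle h
    have h2 : ‖fderiv ℝ G a h‖ ≤ ‖fderiv ℝ G b h‖ + (2 * K : ℝ)⁻¹ * ‖h‖ := by
      have h5 := (fderiv ℝ G b - fderiv ℝ G a).le_of_opNorm_le hb.le h
      have := norm_sub_norm_le (fderiv ℝ G a h) (fderiv ℝ G b h)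
      rw [norm_sub_rev] at this
      simp only [sub_apply] at h5
      linarith
    have h3 : (K : ℝ) * ((2 * K : ℝ)⁻¹ * ‖h‖) = ‖h‖ / 2 := by field_simp
    have h4 := mul_le_mul_of_nonneg_left h2 hK0.le
    rw [mul_add, h3] at h4
    linarith

/-- A `C^1` map is approximated by its derivative, uniformly in the base point. -/
theorem eventually_norm_sub_fderiv_le {E W : Type*} [NormedAddCommGroup E] [NormedSpace ℝ E]
    [NormedAddCommGroup W] [NormedSpace ℝ W] {G : E → W} {a : E}
    (hG : ContDiffAt ℝ 1 G a) {η : ℝ} (hη : 0 < η) :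
    ∀ᶠ p in 𝓝 (a, a), ‖G p.2 - G p.1 - fderiv ℝ G p.1 (p.2 - p.1)‖ ≤ η * ‖p.2 - p.1‖ := by
  have hs := (hG.hasStrictFDerivAt one_ne_zero).isLittleO.def (c := η / 2) (by positivity)
  have hc : ContinuousAt (fderiv ℝ G) a := (hG.fderiv_right (m := 0) (by simp)).continuousAt
  have hc' : ∀ᶠ p : E × E in 𝓝 (a, a), dist (fderiv ℝ G p.1) (fderiv ℝ G a) < η / 2 :=
    (continuousAt_fst (p := (a, a))).eventually
      (Metric.continuousAt_iff'.1 hc (η / 2) (by positivity))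
  have hs' : ∀ᶠ p : E × E in 𝓝 (a, a), _ := (continuous_swap.tendsto (a, a)).eventually hs
  filter_upwards [hs', hc'] with p hp hb
  rw [dist_eq_norm] at hb
  have h5 := (fderiv ℝ G p.1 - fderiv ℝ G a).le_of_opNorm_le hb.le (p.2 - p.1)
  simp only [Prod.swap] at hp
  calc ‖G p.2 - G p.1 - fderiv ℝ G p.1 (p.2 - p.1)‖
      = ‖(G p.2 - G p.1 - fderiv ℝ G a (p.2 - p.1)) -
          (fderiv ℝ G p.1 - fderiv ℝ G a) (p.2 - p.1)‖ := by
        congr 1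
        simp only [sub_apply]
        abel
    _ ≤ _ := norm_sub_le _ _
    _ ≤ η * ‖p.2 - p.1‖ := by linarith

section Geometry

variable {E : Type*} [NormedAddCommGroup E] [NormedSpace ℝ E]
  {M : Type*} [MetricSpace M] [ChartedSpace E M]
  {W : Type*} [NormedAddCommGroup W] [NormedSpace ℝ W]

open MeasureTheory in
/-- The mean value inequality on a Riemannian manifold. -/
theorem norm_sub_le_of_norm_vecDeriv_le
    [RiemannianBundle (fun p : M => TangentSpace 𝓘(ℝ, E) p)] [IsRiemannianManifold 𝓘(ℝ, E) M] {F : M → W}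
    (hF : ContMDiff 𝓘(ℝ, E) 𝓘(ℝ, W) 1 F) {C : ℝ} (hC0 : 0 < C)
    (hC : ∀ (x : M) (v : E), ‖vecDeriv E F x v‖ ≤ C * tanNorm E x v) (x y : M) :
    ‖F x - F y‖ ≤ C * dist x y := by
  suffices H : ∀ ρ : ℝ, dist x y < ρ → ‖F x - F y‖ ≤ C * ρ by
    rw [← div_le_iff₀' hC0]
    refine le_of_forall_gt_imp_ge_of_dense fun ρ hρ => ?_
    rw [div_le_iff₀' hC0]
    exact H ρ hρ
  intro ρ hρ
  have hρ0 : 0 < ρ := dist_nonneg.trans_lt hρ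
  have hlt : riemannianEDist 𝓘(ℝ, E) x y < ENNReal.ofReal ρ := by
    rw [← IsRiemannianManifold.out, edist_dist]
    exact (ENNReal.ofReal_lt_ofReal_iff hρ0).2 hρ
  obtain ⟨γ, rfl, rfl, γ_smooth, hγ⟩ := exists_lt_of_riemannianEDist_lt hlt
  have hs : ContDiffOn ℝ 1 (F ∘ γ) (Icc 0 1) :=
    contMDiffOn_iff_contDiffOn.1 (hF.comp_contMDiffOn γ_smooth)
  have key : ‖(F ∘ γ) 1 - (F ∘ γ) 0‖ₑ ≤ ENNReal.ofReal C * pathELength 𝓘(ℝ, E) γ 0 1 := by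
    refine (enorm_sub_le_lintegral_derivWithin_Icc_of_contDiffOn_Icc hs zero_le_one).trans ?_
    rw [pathELength_eq_lintegral_mfderivWithin_Icc,
      ← lintegral_const_mul' _ _ ENNReal.ofReal_ne_top]
    refine setLIntegral_mono' measurableSet_Icc fun t ht => ?_
    have h1 : mfderivWithin 𝓘(ℝ, ℝ) 𝓘(ℝ, W) (F ∘ γ) (Icc 0 1) t =
        (mfderiv 𝓘(ℝ, E) 𝓘(ℝ, W) F (γ t)) ∘L (mfderivWithin 𝓘(ℝ, ℝ) 𝓘(ℝ, E) γ (Icc 0 1) t) := by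
      apply mfderiv_comp_mfderivWithin
      · exact hF.mdifferentiableAt one_ne_zero
      · exact γ_smooth.mdifferentiableOn one_ne_zero t ht
      · rw [uniqueMDiffWithinAt_iff_uniqueDiffWithinAt]
        exact uniqueDiffOn_Icc zero_lt_one t ht
    have h2 : derivWithin (F ∘ γ) (Icc 0 1) t = vecDeriv E F (γ t)
        (mfderivWithin 𝓘(ℝ, ℝ) 𝓘(ℝ, E) γ (Icc 0 1) t (1 : ℝ)) := by
      rw [← fderivWithin_derivWithin, ← mfderivWithin_eq_fderivWithin]
      exact congr($h1 (1 : ℝ))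
    have h3 := hC (γ t) (mfderivWithin 𝓘(ℝ, ℝ) 𝓘(ℝ, E) γ (Icc 0 1) t (1 : ℝ))
    rw [h2, ← ofReal_norm, ← ofReal_norm, ← ENNReal.ofReal_mul hC0.le]
    exact ENNReal.ofReal_le_ofReal h3
  have h4 : ‖(F ∘ γ) 1 - (F ∘ γ) 0‖ₑ ≤ ENNReal.ofReal C * ENNReal.ofReal ρ := by
    refine key.trans ?_
    gcongr
  rw [← ENNReal.ofReal_mul hC0.le, ← ofReal_norm, ENNReal.ofReal_le_ofReal_iff (by positivity)] at h4
  rw [norm_sub_rev]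
  exact h4

variable [IsManifold 𝓘(ℝ, E) ∞ M]

theorem injective_fderiv_chart {e : M → W} (he : ContMDiff 𝓘(ℝ, E) 𝓘(ℝ, W) 1 e) {x₀ : M}
    (hinj : Function.Injective (vecDeriv E e x₀)) :
    Function.Injective (fderiv ℝ (e ∘ (extChartAt 𝓘(ℝ, E) x₀).symm)
      (extChartAt 𝓘(ℝ, E) x₀ x₀)) := by
  intro h h' hh
  have hs := mem_extChartAt_source (I := 𝓘(ℝ, E)) x₀
  rw [← vecDeriv_chartSymmDeriv hs (he.mdifferentiableAt one_ne_zero),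
    ← vecDeriv_chartSymmDeriv hs (he.mdifferentiableAt one_ne_zero)] at hh
  rw [← vecDeriv_chart_chartSymmDeriv hs h, hinj hh, vecDeriv_chart_chartSymmDeriv hs h']

variable [RiemannianBundle (fun p : M => TangentSpace 𝓘(ℝ, E) p)]
  [IsContMDiffRiemannianBundle 𝓘(ℝ, E) ∞ E (fun p : M => TangentSpace 𝓘(ℝ, E) p)]

/-- The derivative of a `C^1` map on a compact manifold is bounded. -/
theorem exists_norm_vecDeriv_le [CompactSpace M] {F : M → W} (hF : ContMDiff 𝓘(ℝ, E) 𝓘(ℝ, W) 1 F) :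
    ∃ C : ℝ, 0 < C ∧ ∀ (x : M) (v : E), ‖vecDeriv E F x v‖ ≤ C * tanNorm E x v := by
  refine exists_forall_of_forall_eventually
    (P := fun C x => ∀ v : E, ‖vecDeriv E F x v‖ ≤ C * tanNorm E x v) ?_ ?_
  · exact fun C C' hC x hx v =>
      (hx v).trans (mul_le_mul_of_nonneg_right hC (apply_nonneg (tanNorm E x) v))
  · intro x₀
    obtain ⟨C₁, hC₁, h₁⟩ := eventually_norm_chart_le (E := E) x₀
    have hG := contDiffAt_comp_extChartAt_symm hF x₀
    set φ := extChartAt 𝓘(ℝ, E) x₀ with hφ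
    have hc : ContinuousAt (fderiv ℝ (F ∘ φ.symm)) (φ x₀) :=
      (hG.fderiv_right (m := 0) (by simp)).continuousAt
    have hc' : ContinuousAt (fun x => ‖fderiv ℝ (F ∘ φ.symm) (φ x)‖) x₀ :=
      (ContinuousAt.comp (f := φ) hc (continuousAt_extChartAt x₀)).norm
    have h₂ := hc'.eventually_lt_const (lt_add_one ‖fderiv ℝ (F ∘ φ.symm) (φ x₀)‖)
    set C₂ := ‖fderiv ℝ (F ∘ φ.symm) (φ x₀)‖ + 1
    refine ⟨C₂ * C₁, ?_⟩
    filter_upwards [h₁, h₂, extChartAt_source_mem_nhds (I := 𝓘(ℝ, E)) x₀] with x hx₁ hx₂ hxs v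
    rw [← chartSymmDeriv_vecDeriv_chart hxs v,
      vecDeriv_chartSymmDeriv hxs (hF.mdifferentiableAt one_ne_zero),
      chartSymmDeriv_vecDeriv_chart hxs v, mul_assoc]
    refine (ContinuousLinearMap.le_of_opNorm_le _ hx₂.le _).trans ?_
    gcongr
    exact hx₁ v

/-- The derivative of an immersion of a compact manifold is bounded below. -/
theorem exists_tanNorm_le_of_immersion [CompactSpace M] [FiniteDimensional ℝ E] {e : M → W}
    (he : ContMDiff 𝓘(ℝ, E) 𝓘(ℝ, W) 1 e) (hinj : ∀ x, Function.Injective (vecDeriv E e x)) :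
    ∃ C : ℝ, 0 < C ∧ ∀ (x : M) (v : E), tanNorm E x v ≤ C * ‖vecDeriv E e x v‖ := by
  refine exists_forall_of_forall_eventually
    (P := fun C x => ∀ v : E, tanNorm E x v ≤ C * ‖vecDeriv E e x v‖) ?_ ?_
  · exact fun C C' hC x hx v => (hx v).trans (mul_le_mul_of_nonneg_right hC (norm_nonneg _))
  · intro x₀
    obtain ⟨C₁, hC₁, h₁⟩ := eventually_tanNorm_chartSymmDeriv_le (E := E) x₀
    obtain ⟨C₂, hC₂, -, h₂⟩ := eventually_norm_sub_le_of_injective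
      (contDiffAt_comp_extChartAt_symm he x₀) (injective_fderiv_chart he (hinj x₀))
    have h₂' := (continuousAt_extChartAt (I := 𝓘(ℝ, E)) x₀).eventually h₂
    refine ⟨C₁ * C₂, ?_⟩
    filter_upwards [h₁, h₂', extChartAt_source_mem_nhds (I := 𝓘(ℝ, E)) x₀] with x hx₁ hx₂ hxs v
    rw [← chartSymmDeriv_vecDeriv_chart hxs v,
      vecDeriv_chartSymmDeriv hxs (he.mdifferentiableAt one_ne_zero), mul_assoc]
    refine (hx₁ _).trans ?_
    gcongr
    exact hx₂ _

open MeasureTheory in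
/-- Near every point, the Riemannian distance is bounded by the distance in a chart: the preimage of
a segment in the chart is a short path. -/
theorem eventually_dist_le_chart [IsRiemannianManifold 𝓘(ℝ, E) M] (x₀ : M) :
    ∃ C : ℝ, 0 < C ∧ ∀ᶠ z in 𝓝 (x₀, x₀),
      dist z.1 z.2 ≤ C * ‖extChartAt 𝓘(ℝ, E) x₀ z.1 - extChartAt 𝓘(ℝ, E) x₀ z.2‖ := by
  obtain ⟨C, C_pos, hC⟩ := eventually_tanNorm_chartSymmDeriv_le (E := E) x₀
  refine ⟨C, C_pos, ?_⟩
  have hC' : ∀ᶠ y in 𝓝 (extChartAt 𝓘(ℝ, E) x₀ x₀), ∀ h : E,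
      tanNorm E ((extChartAt 𝓘(ℝ, E) x₀).symm y)
        (chartSymmDeriv E x₀ ((extChartAt 𝓘(ℝ, E) x₀).symm y) h) ≤ C * ‖h‖ := by
    have := continuousAt_extChartAt_symm (I := 𝓘(ℝ, E)) x₀
    rw [ContinuousAt, extChartAt_to_inv] at this
    exact this.eventually hC
  obtain ⟨r, r_pos, hr⟩ : ∃ r > 0, Metric.ball (extChartAt 𝓘(ℝ, E) x₀ x₀) r ⊆
      (extChartAt 𝓘(ℝ, E) x₀).target ∩ {y | ∀ h : E, tanNorm E ((extChartAt 𝓘(ℝ, E) x₀).symm y)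
        (chartSymmDeriv E x₀ ((extChartAt 𝓘(ℝ, E) x₀).symm y) h) ≤ C * ‖h‖} :=
    Metric.mem_nhds_iff.1 (inter_mem (extChartAt_target_mem_nhds x₀) hC')
  have A : (extChartAt 𝓘(ℝ, E) x₀) ⁻¹' (Metric.ball (extChartAt 𝓘(ℝ, E) x₀ x₀) r) ∩
      (extChartAt 𝓘(ℝ, E) x₀).source ∈ 𝓝 x₀ :=
    inter_mem ((continuousAt_extChartAt x₀).preimage_mem_nhds (Metric.ball_mem_nhds _ r_pos))
      (extChartAt_source_mem_nhds x₀)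
  filter_upwards [prod_mem_nhds A A] with z hz
  obtain ⟨⟨hz1, hz1s⟩, ⟨hz2, hz2s⟩⟩ := hz
  let η := ContinuousAffineMap.lineMap (R := ℝ) (extChartAt 𝓘(ℝ, E) x₀ z.1)
    (extChartAt 𝓘(ℝ, E) x₀ z.2)
  set γ := (extChartAt 𝓘(ℝ, E) x₀).symm ∘ η
  have hη : Icc 0 1 ⊆ ⇑η ⁻¹' ((extChartAt 𝓘(ℝ, E) x₀).target ∩
        {y | ∀ h : E, tanNorm E ((extChartAt 𝓘(ℝ, E) x₀).symm y)
          (chartSymmDeriv E x₀ ((extChartAt 𝓘(ℝ, E) x₀).symm y) h) ≤ C * ‖h‖}) := by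
    simp only [← image_subset_iff, ContinuousAffineMap.coe_lineMap_eq,
      ← segment_eq_image_lineMap, η]
    refine Subset.trans ?_ hr
    simpa using (convex_ball _ _).segment_subset hz1 hz2
  simp only [preimage_inter, subset_inter_iff] at hη
  have η_smooth : ContMDiffOn 𝓘(ℝ, ℝ) 𝓘(ℝ, E) 1 η (Icc 0 1) := by
    apply ContMDiff.contMDiffOn
    rw [contMDiff_iff_contDiff]
    exact ContinuousAffineMap.contDiff _
  have hlen : riemannianEDist 𝓘(ℝ, E) z.1 z.2 ≤ pathELength 𝓘(ℝ, E) γ 0 1 := by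
    apply riemannianEDist_le_pathELength _ _ _ zero_le_one
    · exact (contMDiffOn_extChartAt_symm x₀).comp η_smooth hη.1
    · simpa [γ, η, ContinuousAffineMap.coe_lineMap_eq] using (extChartAt 𝓘(ℝ, E) x₀).left_inv hz1s
    · simpa [γ, η, ContinuousAffineMap.coe_lineMap_eq] using (extChartAt 𝓘(ℝ, E) x₀).left_inv hz2s
  rw [← IsRiemannianManifold.out] at hlen
  have hfin : pathELength 𝓘(ℝ, E) γ 0 1 ≤
      ENNReal.ofReal C * edist (extChartAt 𝓘(ℝ, E) x₀ z.1) (extChartAt 𝓘(ℝ, E) x₀ z.2) := by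
    rw [← lintegral_fderiv_lineMap_eq_edist, pathELength_eq_lintegral_mfderivWithin_Icc,
      ← lintegral_const_mul' _ _ ENNReal.ofReal_ne_top]
    apply setLIntegral_mono' measurableSet_Icc (fun t ht ↦ ?_)
    have h1 : mfderivWithin 𝓘(ℝ, ℝ) 𝓘(ℝ, E) γ (Icc 0 1) t =
        (mfderivWithin 𝓘(ℝ, E) 𝓘(ℝ, E) (extChartAt 𝓘(ℝ, E) x₀).symm (range 𝓘(ℝ, E)) (η t)) ∘L
          (mfderivWithin 𝓘(ℝ, ℝ) 𝓘(ℝ, E) η (Icc 0 1) t) := by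
      apply mfderivWithin_comp
      · exact mdifferentiableWithinAt_extChartAt_symm (hη.1 ht)
      · exact η_smooth.mdifferentiableOn one_ne_zero t ht
      · exact hη.1.trans (preimage_mono (extChartAt_target_subset_range x₀))
      · rw [uniqueMDiffWithinAt_iff_uniqueDiffWithinAt]
        exact uniqueDiffOn_Icc zero_lt_one t ht
    have h2 : mfderivWithin 𝓘(ℝ, ℝ) 𝓘(ℝ, E) γ (Icc 0 1) t 1 =
        (mfderivWithin 𝓘(ℝ, E) 𝓘(ℝ, E) (extChartAt 𝓘(ℝ, E) x₀).symm (range 𝓘(ℝ, E)) (η t))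
          (mfderivWithin 𝓘(ℝ, ℝ) 𝓘(ℝ, E) η (Icc 0 1) t 1) := congr($h1 (1 : ℝ))
    have h4 := hη.2 ht (mfderivWithin 𝓘(ℝ, ℝ) 𝓘(ℝ, E) η (Icc 0 1) t (1 : ℝ))
    rw [chartSymmDeriv, (extChartAt 𝓘(ℝ, E) x₀).right_inv (hη.1 ht)] at h4
    rw [h2, ← ofReal_norm, ← ofReal_norm, ← ENNReal.ofReal_mul C_pos.le]
    refine ENNReal.ofReal_le_ofReal (h4.trans_eq ?_)
    rw [mfderivWithin_eq_fderivWithin]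
    rfl
  have h3 := hlen.trans hfin
  rw [edist_dist, edist_dist,
    ← ENNReal.ofReal_mul C_pos.le, ENNReal.ofReal_le_ofReal_iff (by positivity),
    dist_eq_norm (extChartAt 𝓘(ℝ, E) x₀ z.1)] at h3
  exact h3

end Geometry

/-! ### Displacement vectors -/

section Geometry

variable {E : Type*} [NormedAddCommGroup E] [NormedSpace ℝ E] [FiniteDimensional ℝ E]
  {M : Type*} [MetricSpace M] [CompactSpace M] [ChartedSpace E M] [IsManifold 𝓘(ℝ, E) ∞ M]
  {W W' : Type*} [NormedAddCommGroup W] [NormedSpace ℝ W]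
  [NormedAddCommGroup W'] [NormedSpace ℝ W']
  [RiemannianBundle (fun p : M => TangentSpace 𝓘(ℝ, E) p)]
  [IsContMDiffRiemannianBundle 𝓘(ℝ, E) ∞ E (fun p : M => TangentSpace 𝓘(ℝ, E) p)]
  [IsRiemannianManifold 𝓘(ℝ, E) M]

/-- An immersion does not contract small distances by more than a constant factor. -/
theorem exists_dist_le_of_immersion {e : M → W}
    (he : ContMDiff 𝓘(ℝ, E) 𝓘(ℝ, W) 1 e) (hinj : ∀ x, Function.Injective (vecDeriv E e x)) :
    ∃ C : ℝ, 0 < C ∧ ∃ ε : ℝ, 0 < ε ∧ ∀ x y : M, dist x y < ε → dist x y ≤ C * ‖e x - e y‖ := by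
  refine exists_forall_dist_lt_of_forall_eventually
    (P := fun C x y => dist x y ≤ C * ‖e x - e y‖) ?_ ?_
  · exact fun C C' hC x y hx => hx.trans (mul_le_mul_of_nonneg_right hC (norm_nonneg _))
  · intro x₀
    obtain ⟨C₁, hC₁, h₁⟩ := eventually_dist_le_chart (E := E) x₀
    obtain ⟨C₂, hC₂, h₂, -⟩ := eventually_norm_sub_le_of_injective
      (contDiffAt_comp_extChartAt_symm he x₀) (injective_fderiv_chart he (hinj x₀))
    have hφ := continuousAt_extChartAt (I := 𝓘(ℝ, E)) x₀
    have h₂' := (hφ.prodMap' hφ).eventually h₂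
    have hs := extChartAt_source_mem_nhds (I := 𝓘(ℝ, E)) x₀
    refine ⟨C₁ * C₂, ?_⟩
    filter_upwards [h₁, h₂', prod_mem_nhds hs hs] with z hz₁ hz₂ hzs
    refine hz₁.trans ?_
    rw [mul_assoc]
    gcongr
    simpa only [Prod.map_fst, Prod.map_snd, Function.comp_apply,
      (extChartAt 𝓘(ℝ, E) x₀).left_inv hzs.1, (extChartAt 𝓘(ℝ, E) x₀).left_inv hzs.2] using hz₂

/-- The displacement of close points is represented by a tangent vector, up to an error that is
small compared to their distance. The immersion `e` only serves to bound distances in charts. -/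
theorem exists_tangent_approximation {e : M → W} {F : M → W'}
    (he : ContMDiff 𝓘(ℝ, E) 𝓘(ℝ, W) 1 e) (hinj : ∀ x, Function.Injective (vecDeriv E e x))
    (hF : ContMDiff 𝓘(ℝ, E) 𝓘(ℝ, W') 1 F) {η : ℝ} (hη : 0 < η) :
    ∃ ε : ℝ, 0 < ε ∧ ∀ x y : M, dist x y < ε →
      ∃ v : E, ‖F y - F x - vecDeriv E F x v‖ ≤ η * dist x y := by
  obtain ⟨L, hL, hL'⟩ := exists_norm_vecDeriv_le (E := E) he
  -- The compactness lemma also produces a constant, on which this statement does not depend.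
  suffices ∃ C : ℝ, 0 < C ∧ ∃ ε : ℝ, 0 < ε ∧ ∀ x y : M, dist x y < ε →
      ∃ v : E, ‖F y - F x - vecDeriv E F x v‖ ≤ η * dist x y from this.choose_spec.2
  refine exists_forall_dist_lt_of_forall_eventually
    (P := fun _ x y => ∃ v : E, ‖F y - F x - vecDeriv E F x v‖ ≤ η * dist x y)
    (fun _ _ _ _ _ h => h) fun x₀ => ?_
  obtain ⟨C, hC, h₂, -⟩ := eventually_norm_sub_le_of_injective
    (contDiffAt_comp_extChartAt_symm he x₀) (injective_fderiv_chart he (hinj x₀))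
  have h₁ := eventually_norm_sub_fderiv_le (contDiffAt_comp_extChartAt_symm hF x₀)
    (η := η / (C * L)) (by positivity)
  have hφ := continuousAt_extChartAt (I := 𝓘(ℝ, E)) x₀
  have h₁' := (hφ.prodMap' hφ).eventually h₁
  have h₂' := (hφ.prodMap' hφ).eventually h₂
  have hs := extChartAt_source_mem_nhds (I := 𝓘(ℝ, E)) x₀
  refine ⟨0, ?_⟩
  filter_upwards [h₁', h₂', prod_mem_nhds hs hs] with z hz₁ hz₂ hzs
  refine ⟨chartSymmDeriv E x₀ z.1
    (extChartAt 𝓘(ℝ, E) x₀ z.2 - extChartAt 𝓘(ℝ, E) x₀ z.1), ?_⟩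
  rw [vecDeriv_chartSymmDeriv hzs.1 (hF.mdifferentiableAt one_ne_zero)]
  simp only [Prod.map_fst, Prod.map_snd, Function.comp_apply,
    (extChartAt 𝓘(ℝ, E) x₀).left_inv hzs.1, (extChartAt 𝓘(ℝ, E) x₀).left_inv hzs.2] at hz₁ hz₂
  refine hz₁.trans ?_
  rw [norm_sub_rev] at hz₂
  have h3 := hz₂.trans (mul_le_mul_of_nonneg_left
    (norm_sub_le_of_norm_vecDeriv_le he hL hL' z.1 z.2) hC.le)
  calc η / (C * L) * _ ≤ η / (C * L) * (C * (L * dist z.1 z.2)) := by gcongr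
    _ = η * dist z.1 z.2 := by field_simp

/-- A nonlinear orbit pair is an approximate orbit of the derivative cocycle: close points `x`, `y`
are joined by a tangent vector `V x y ∈ T_x M`, of length comparable to their distance, so that
`V (f x) (f y)` is `D_x f (V x y)` up to a relative error `η`. -/
theorem exists_displacement {f : M → M} (hf : ContMDiff 𝓘(ℝ, E) 𝓘(ℝ, E) 1 f) :
    ∃ K : ℝ, 0 < K ∧ (∀ (x : M) (v : E), tanNorm E (f x) (tanDeriv E f x v) ≤ K * tanNorm E x v) ∧
      ∀ η : ℝ, 0 < η → ∃ ε : ℝ, 0 < ε ∧ ∃ V : M → M → E, ∀ x y : M, dist x y < ε →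
        dist x y ≤ K * tanNorm E x (V x y) ∧ tanNorm E x (V x y) ≤ K * dist x y ∧
        (dist (f x) (f y) < ε → tanNorm E (f x) (V (f x) (f y) - tanDeriv E f x (V x y)) ≤
          η * tanNorm E x (V x y)) := by
  obtain ⟨n, e, he', -, hinj'⟩ := exists_embedding_euclidean_of_compact (I := 𝓘(ℝ, E)) (M := M)
  have hinj : ∀ x, Function.Injective (vecDeriv E e x) := hinj'
  have he : ContMDiff 𝓘(ℝ, E) 𝓘(ℝ, EuclideanSpace ℝ (Fin n)) 1 e := he'.of_le (by simp)
  have hef : ContMDiff 𝓘(ℝ, E) 𝓘(ℝ, EuclideanSpace ℝ (Fin n)) 1 (e ∘ f) := he.comp hf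
  obtain ⟨L, hL, hL'⟩ := exists_norm_vecDeriv_le (E := E) he
  obtain ⟨L₁, hL₁, hL₁'⟩ := exists_norm_vecDeriv_le (E := E) hef
  obtain ⟨c, hc, hc'⟩ := exists_tanNorm_le_of_immersion he hinj
  obtain ⟨C, hC, ε₁, hε₁, hC'⟩ := exists_dist_le_of_immersion he hinj
  have hcomp : ∀ x v, vecDeriv E (e ∘ f) x v = vecDeriv E e (f x) (tanDeriv E f x v) := fun x v => by
    rw [vecDeriv_comp (hf.mdifferentiableAt one_ne_zero) (he.mdifferentiableAt one_ne_zero)]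
    rfl
  obtain ⟨K, hK⟩ : ∃ K : ℝ, c * L₁ ≤ K ∧ 2 * C * L ≤ K ∧ c * (L + 1) ≤ K :=
    ⟨max (c * L₁) (max (2 * C * L) (c * (L + 1))), by simp⟩
  have hK0 : 0 < K := lt_of_lt_of_le (by positivity) hK.1
  refine ⟨K, hK0, fun x v => ?_, fun η hη => ?_⟩
  · refine (hc' _ _).trans ?_
    rw [← hcomp]
    calc c * ‖vecDeriv E (e ∘ f) x v‖ ≤ c * (L₁ * tanNorm E x v) := by
          gcongr
          exact hL₁' x v
      _ = c * L₁ * tanNorm E x v := by ring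
      _ ≤ K * tanNorm E x v := by
          gcongr
          exact hK.1
  obtain ⟨η', hη', h1, h2, h3⟩ : ∃ η' : ℝ, 0 < η' ∧ η' ≤ 1 ∧ C * η' ≤ 1 / 2 ∧
      c * (η' * (C * L₁ + 1)) * K ≤ η := by
    refine ⟨min 1 (min (1 / (2 * C)) (η / (c * (C * L₁ + 1) * K))), by positivity,
      min_le_left _ _, ?_, ?_⟩
    · calc _ ≤ C * (1 / (2 * C)) := by
            gcongr
            exact (min_le_right _ _).trans (min_le_left _ _)
        _ = 1 / 2 := by field_simp
    · calc _ ≤ c * (η / (c * (C * L₁ + 1) * K) * (C * L₁ + 1)) * K := by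
            gcongr
            exact (min_le_right _ _).trans (min_le_right _ _)
        _ = η := by field_simp
  -- Approximating `e` and `e ∘ f` by the same tangent vectors makes `V` compatible with `f`.
  obtain ⟨ε₂, hε₂, happ⟩ := exists_tangent_approximation he hinj (he.prodMk_space hef) hη'
  choose! V hV using happ
  have hV1 : ∀ x y, dist x y < ε₂ → ‖e y - e x - vecDeriv E e x (V x y)‖ ≤ η' * dist x y := by
    intro x y hxy
    have := hV x y hxy
    rw [vecDeriv_prodMk (he.mdifferentiableAt one_ne_zero) (hef.mdifferentiableAt one_ne_zero)]
      at this
    exact (norm_fst_le _).trans this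
  have hV2 : ∀ x y, dist x y < ε₂ →
      ‖e (f y) - e (f x) - vecDeriv E e (f x) (tanDeriv E f x (V x y))‖ ≤ η' * dist x y := by
    intro x y hxy
    have := hV x y hxy
    rw [vecDeriv_prodMk (he.mdifferentiableAt one_ne_zero) (hef.mdifferentiableAt one_ne_zero)]
      at this
    rw [← hcomp]
    exact (norm_snd_le _).trans this
  refine ⟨min ε₁ ε₂, lt_min hε₁ hε₂, V, fun x y hxy => ?_⟩
  have hxy₁ := hxy.trans_le (min_le_left _ _)
  have hxy₂ := hxy.trans_le (min_le_right _ _)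
  have a1 := hV1 x y hxy₂
  have hd := dist_nonneg (x := x) (y := y)
  have hlow : dist x y ≤ K * tanNorm E x (V x y) := by
    have b1 : ‖e x - e y‖ ≤ L * tanNorm E x (V x y) + η' * dist x y := by
      have := norm_sub_norm_le (e y - e x) (vecDeriv E e x (V x y))
      rw [norm_sub_rev]
      linarith [hL' x (V x y)]
    have b2 := (hC' x y hxy₁).trans (mul_le_mul_of_nonneg_left b1 hC.le)
    have b3 := mul_le_mul_of_nonneg_right h2 hd
    have b4 := mul_le_mul_of_nonneg_right hK.2.1 (apply_nonneg (tanNorm E x) (V x y))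
    linarith
  refine ⟨hlow, ?_, fun hfxy => ?_⟩
  · have b1 : ‖vecDeriv E e x (V x y)‖ ≤ (L + 1) * dist x y := by
      have := norm_sub_norm_le (vecDeriv E e x (V x y)) (e y - e x)
      rw [norm_sub_rev (vecDeriv E e x (V x y))] at this
      have b2 := norm_sub_le_of_norm_vecDeriv_le he hL hL' y x
      rw [dist_comm] at b2
      have := mul_le_mul_of_nonneg_right h1 hd
      linarith
    calc _ ≤ c * ‖vecDeriv E e x (V x y)‖ := hc' _ _
      _ ≤ c * ((L + 1) * dist x y) := by gcongr
      _ = c * (L + 1) * dist x y := by ring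
      _ ≤ _ := by
        gcongr
        exact hK.2.2
  · have c1 := hV1 (f x) (f y) (hfxy.trans_le (min_le_right _ _))
    have c2 := hV2 x y hxy₂
    have c3 : dist (f x) (f y) ≤ C * L₁ * dist x y := by
      refine (hC' _ _ (hfxy.trans_le (min_le_left _ _))).trans ?_
      rw [mul_assoc]
      gcongr
      exact norm_sub_le_of_norm_vecDeriv_le hef hL₁ hL₁' x y
    have c4 : ‖vecDeriv E e (f x) (V (f x) (f y) - tanDeriv E f x (V x y))‖ ≤
        η' * (C * L₁ + 1) * dist x y := by
      rw [map_sub]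
      calc _ = ‖(e (f y) - e (f x) - vecDeriv E e (f x) (tanDeriv E f x (V x y))) -
              (e (f y) - e (f x) - vecDeriv E e (f x) (V (f x) (f y)))‖ := by
            congr 1
            abel
        _ ≤ _ := norm_sub_le _ _
        _ ≤ η' * dist x y + η' * (C * L₁ * dist x y) :=
          add_le_add c2 (c1.trans (by gcongr))
        _ = _ := by ring
    calc _ ≤ c * ‖vecDeriv E e (f x) (V (f x) (f y) - tanDeriv E f x (V x y))‖ := hc' _ _
      _ ≤ c * (η' * (C * L₁ + 1) * (K * tanNorm E x (V x y))) := by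
        gcongr
        exact c4.trans (by gcongr)
      _ = c * (η' * (C * L₁ + 1)) * K * tanNorm E x (V x y) := by ring
      _ ≤ _ := by gcongr

end Geometry

/-! ### Linear cocycles with a partially hyperbolic splitting -/

section Cocycle

variable {E : Type*} [AddCommGroup E] [Module ℝ E]

/-- The composition `D (i + n - 1) ∘ ⋯ ∘ D i` of `n` consecutive maps of a sequence. -/
def cocycleIter (D : ℕ → E →ₗ[ℝ] E) (i : ℕ) : ℕ → E →ₗ[ℝ] E
  | 0 => LinearMap.id
  | n + 1 => D (i + n) ∘ₗ cocycleIter D i n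

/-- A sequence of linear maps `D i : (E, N i) → (E, N (i + 1))` with a partially hyperbolic splitting
`E = S i ⊕ C i ⊕ U i`. On `C i` the maps are conformal: they multiply the norm by `A (i + 1) / A i`,
as is the case for line bundles. All constants (of the rates, and the bound of `D`) are the same
number `K`. -/
structure IsPartiallyHyperbolicCocycle (N : ℕ → Seminorm ℝ E) (D : ℕ → E →ₗ[ℝ] E)
    (S C U : ℕ → Submodule ℝ E) (A : ℕ → ℝ) (K ls l₁ l₂ lu : ℝ) : Prop where
  map_le : ∀ i v, N (i + 1) (D i v) ≤ K * N i v
  exists_decomp : ∀ i v, ∃ s ∈ S i, ∃ c ∈ C i, ∃ u ∈ U i, v = s + c + u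
  map_s : ∀ i, ∀ v ∈ S i, D i v ∈ S (i + 1)
  map_c : ∀ i, ∀ v ∈ C i, D i v ∈ C (i + 1)
  map_u : ∀ i, ∀ v ∈ U i, D i v ∈ U (i + 1)
  surj_u : ∀ i, ∀ w ∈ U (i + 1), ∃ v ∈ U i, D i v = w
  s_le : ∀ i n, ∀ v ∈ S i, N (i + n) (cocycleIter D i n v) ≤ K * ls ^ n * N i v
  c_eq : ∀ i n, ∀ v ∈ C i, N (i + n) (cocycleIter D i n v) = A (i + n) / A i * N i v
  u_ge : ∀ i n, ∀ v ∈ U i, K⁻¹ * lu ^ n * N i v ≤ N (i + n) (cocycleIter D i n v)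
  growth_zero : A 0 = 1
  growth_pos : ∀ i, 0 < A i
  le_growth : ∀ i n, K⁻¹ * l₁ ^ n * A i ≤ A (i + n)
  growth_le : ∀ i n, A (i + n) ≤ K * l₂ ^ n * A i

theorem cocycleIter_succ_apply (D : ℕ → E →ₗ[ℝ] E) (i n : ℕ) (v : E) :
    cocycleIter D i (n + 1) v = D (i + n) (cocycleIter D i n v) := rfl

theorem cocycleIter_mem {D : ℕ → E →ₗ[ℝ] E} {P : ℕ → Submodule ℝ E}
    (hP : ∀ i, ∀ v ∈ P i, D i v ∈ P (i + 1)) (i n : ℕ) {v : E} (hv : v ∈ P i) :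
    cocycleIter D i n v ∈ P (i + n) := by
  induction n with
  | zero => exact hv
  | succ n ih => exact hP _ _ ih

theorem exists_cocycleIter_eq {D : ℕ → E →ₗ[ℝ] E} {P : ℕ → Submodule ℝ E}
    (hP : ∀ i, ∀ w ∈ P (i + 1), ∃ v ∈ P i, D i v = w) (i n : ℕ) {w : E} (hw : w ∈ P (i + n)) :
    ∃ v ∈ P i, cocycleIter D i n v = w := by
  induction n generalizing w with
  | zero => exact ⟨w, hw, rfl⟩
  | succ n ih =>
    obtain ⟨w', hw', rfl⟩ := hP _ w hw
    obtain ⟨v, hv, rfl⟩ := ih hw'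
    exact ⟨v, hv, rfl⟩

theorem cocycleIter_le {N : ℕ → Seminorm ℝ E} {D : ℕ → E →ₗ[ℝ] E} {K : ℝ} (hK : 0 ≤ K)
    (h : ∀ i v, N (i + 1) (D i v) ≤ K * N i v) (i n : ℕ) (v : E) :
    N (i + n) (cocycleIter D i n v) ≤ K ^ n * N i v := by
  induction n with
  | zero => simp [cocycleIter]
  | succ n ih =>
    calc _ ≤ K * N (i + n) (cocycleIter D i n v) := h _ _
      _ ≤ K * (K ^ n * N i v) := by gcongr
      _ = _ := by ring

/-! ### Variation of constants -/

theorem eq_cocycleIter_add_sum {D : ℕ → E →ₗ[ℝ] E} {p e : ℕ → E}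
    (hrec : ∀ i, p (i + 1) = D i (p i) + e i) (j : ℕ) :
    p j = cocycleIter D 0 j (p 0) +
      ∑ k ∈ Finset.range j, cocycleIter D (k + 1) (j - 1 - k) (e k) := by
  induction j with
  | zero => simp [cocycleIter]
  | succ j ih =>
    rw [hrec, Finset.sum_range_succ, ← add_assoc]
    congr 1
    · conv_lhs => rw [ih]
      rw [map_add, map_sum, cocycleIter_succ_apply, zero_add]
      congr 1
      refine Finset.sum_congr rfl fun k hk => ?_
      have hk := Finset.mem_range.1 hk
      rw [show j + 1 - 1 - k = j - 1 - k + 1 by omega, cocycleIter_succ_apply,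
        show k + 1 + (j - 1 - k) = j by omega]
    · simp [cocycleIter]

/-- Perturbed orbits in an invariant family of subspaces, with growth bounded by `g`. -/
theorem seminorm_le_of_growth_le {N : ℕ → Seminorm ℝ E} {D : ℕ → E →ₗ[ℝ] E}
    {P : ℕ → Submodule ℝ E} {g : ℕ → ℕ → ℝ}
    (hg : ∀ i n, ∀ v ∈ P i, N (i + n) (cocycleIter D i n v) ≤ g i n * N i v) {p e : ℕ → E}
    (hp : p 0 ∈ P 0) (he : ∀ i, e i ∈ P (i + 1)) (hrec : ∀ i, p (i + 1) = D i (p i) + e i) (j : ℕ) :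
    N j (p j) ≤ g 0 j * N 0 (p 0) +
      ∑ k ∈ Finset.range j, g (k + 1) (j - 1 - k) * N (k + 1) (e k) := by
  rw [eq_cocycleIter_add_sum hrec j]
  refine (map_add_le_add _ _ _).trans (add_le_add ?_ ?_)
  · simpa [cocycleIter] using hg 0 j _ hp
  · refine (Finset.le_sum_of_subadditive (N j) (map_zero _).le (map_add_le_add _) _ _).trans (Finset.sum_le_sum fun k hk => ?_)
    have hk := Finset.mem_range.1 hk
    have := hg (k + 1) (j - 1 - k) _ (he k)
    rwa [show k + 1 + (j - 1 - k) = j by omega] at this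

/-- Perturbed orbits in an expanded invariant family of subspaces are bounded by their end point:
the perturbations are pulled back to the initial time. -/
theorem seminorm_le_of_expanding {N : ℕ → Seminorm ℝ E} {D : ℕ → E →ₗ[ℝ] E}
    {P : ℕ → Submodule ℝ E} {g : ℕ → ℝ}
    (hg : ∀ i n, ∀ v ∈ P i, N i v ≤ g n * N (i + n) (cocycleIter D i n v))
    (hmap : ∀ i, ∀ v ∈ P i, D i v ∈ P (i + 1))
    (hsurj : ∀ i, ∀ w ∈ P (i + 1), ∃ v ∈ P i, D i v = w) {p e : ℕ → E}
    (hp : p 0 ∈ P 0) (he : ∀ i, e i ∈ P (i + 1)) (hrec : ∀ i, p (i + 1) = D i (p i) + e i)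
    (j n : ℕ) :
    N j (p j) ≤ g n * N (j + n) (p (j + n)) +
      ∑ k ∈ Finset.range n, g (k + 1) * N (j + k + 1) (e (j + k)) := by
  have hpP : ∀ i, p i ∈ P i := fun i => by
    induction i with
    | zero => exact hp
    | succ i ih =>
      rw [hrec]
      exact add_mem (hmap _ _ ih) (he i)
  have key : ∃ w ∈ P j, cocycleIter D j n w = p (j + n) ∧
      N j (p j - w) ≤ ∑ k ∈ Finset.range n, g (k + 1) * N (j + k + 1) (e (j + k)) := by
    induction n with
    | zero => exact ⟨p j, hpP j, rfl, by simp⟩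
    | succ n ih =>
      obtain ⟨w, hw, hwp, hwN⟩ := ih
      obtain ⟨w', hw', hwe⟩ := exists_cocycleIter_eq hsurj j (n + 1) (he (j + n))
      refine ⟨w + w', add_mem hw hw', ?_, ?_⟩
      · rw [map_add, cocycleIter_succ_apply, hwp, hwe, ← hrec]
        rfl
      · rw [Finset.sum_range_succ, ← sub_sub]
        refine (map_sub_le_add _ _ _).trans (add_le_add hwN ?_)
        have := hg j (n + 1) w' hw'
        rwa [hwe] at this
  obtain ⟨w, hw, hwp, hwN⟩ := key
  calc N j (p j) = N j (w + (p j - w)) := by rw [add_sub_cancel]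
    _ ≤ N j w + N j (p j - w) := map_add_le_add _ _ _
    _ ≤ _ := add_le_add (hwp ▸ hg j n w hw) hwN

/-! ### Angles between the subspaces -/

/-- If `n` is large enough for the growth `K a ^ n` to be beaten by `K⁻¹ b ^ n`, then vectors with
these growths make a uniformly large angle. -/
theorem exists_le_mul_add_of_growth {K a b : ℝ} (hK : 0 < K) (ha : 0 < a) (hab : a < b) :
    ∃ (n : ℕ) (B : ℝ), 1 ≤ B ∧ ∀ (N N' : Seminorm ℝ E) (Φ : E →ₗ[ℝ] E) (p q : E),
      (∀ v, N' (Φ v) ≤ K ^ n * N v) → N' (Φ p) ≤ K * a ^ n * N p →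
      K⁻¹ * b ^ n * N q ≤ N' (Φ q) → N p ≤ B * N (p + q) ∧ N q ≤ B * N (p + q) := by
  have hb : 0 < b := ha.trans hab
  obtain ⟨n, hn⟩ := exists_pow_lt_of_lt_one (show 0 < 1 / (2 * K ^ 2) by positivity)
    ((div_lt_one hb).2 hab)
  have hn' : K * a ^ n ≤ K⁻¹ * b ^ n / 2 := by
    rw [div_pow, div_lt_iff₀ (by positivity)] at hn
    calc K * a ^ n ≤ K * (1 / (2 * K ^ 2) * b ^ n) := by gcongr
      _ = _ := by field_simp
  set t := K⁻¹ * b ^ n with ht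
  have ht0 : 0 < t := by positivity
  refine ⟨n, 2 * K ^ n / t + 2, by linarith [show 0 < 2 * K ^ n / t by positivity],
    fun N N' Φ p q hΦ hp hq => ?_⟩
  have h1 : N' (Φ q) ≤ N' (Φ (p + q)) + N' (Φ p) := by
    have := map_sub_le_add N' (Φ (p + q)) (Φ p)
    rwa [← map_sub, add_sub_cancel_left] at this
  have h2 : N p ≤ N (p + q) + N q := by
    have := map_sub_le_add N (p + q) q
    rwa [add_sub_cancel_right] at this
  have h3 := hΦ (p + q)
  have h4 : K * a ^ n * N p ≤ t / 2 * (N (p + q) + N q) :=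
    mul_le_mul hn' h2 (apply_nonneg _ _) (by positivity)
  have h5 : N q ≤ (2 * K ^ n / t + 1) * N (p + q) := by
    have h6 : t * N q ≤ (2 * K ^ n + t) * N (p + q) := by linarith
    rw [← mul_le_mul_iff_right₀ ht0]
    refine h6.trans_eq ?_
    field_simp
  have h0 := apply_nonneg N (p + q)
  constructor <;> linarith

/-- The components of a vector are bounded by the vector, with a constant that depends on the rates
only. -/
theorem IsPartiallyHyperbolicCocycle.exists_decomp_bound {K ls l₁ l₂ lu : ℝ} (hK : 1 ≤ K)
    (hls : 0 < ls) (h₁ : ls < l₁) (h₁₂ : l₁ ≤ l₂) (h₂ : l₂ < lu) :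
    ∃ B : ℝ, 1 ≤ B ∧ ∀ (N : ℕ → Seminorm ℝ E) (D : ℕ → E →ₗ[ℝ] E) (S C U : ℕ → Submodule ℝ E)
      (A : ℕ → ℝ), IsPartiallyHyperbolicCocycle N D S C U A K ls l₁ l₂ lu →
      ∀ i, ∀ s ∈ S i, ∀ c ∈ C i, ∀ u ∈ U i, N i s ≤ B * N i (s + c + u) ∧
        N i c ≤ B * N i (s + c + u) ∧ N i u ≤ B * N i (s + c + u) := by
  have hK0 : 0 < K := by linarith
  have hl₁ : 0 < l₁ := hls.trans h₁
  have hl₂ : 0 < l₂ := hl₁.trans_le h₁₂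
  have hlu : 0 < lu := hl₂.trans h₂
  obtain ⟨n, B, hB, H⟩ := exists_le_mul_add_of_growth (E := E) hK0 hls h₁
  obtain ⟨n', B', hB', H'⟩ := exists_le_mul_add_of_growth (E := E)
    (K := 2 * K * B) (by positivity) hl₂ h₂
  have hKB : K ≤ 2 * K * B := by nlinarith
  refine ⟨B * B', by nlinarith, fun N D S C U A h i s hs c hc u hu => ?_⟩
  have hgc : ∀ n, N (i + n) (cocycleIter D i n c) ≤ K * l₂ ^ n * N i c ∧
      K⁻¹ * l₁ ^ n * N i c ≤ N (i + n) (cocycleIter D i n c) := fun n => by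
    rw [h.c_eq i n c hc]
    have := h.growth_pos i
    constructor
    · gcongr
      rw [div_le_iff₀ this]
      exact h.growth_le i n
    · gcongr
      rw [le_div_iff₀ this]
      exact h.le_growth i n
  obtain ⟨hsB, hcB⟩ := H (N i) (N (i + n)) (cocycleIter D i n) s c
    (cocycleIter_le hK0.le h.map_le i n) (h.s_le i n s hs) (hgc n).2
  have hsc : N (i + n') (cocycleIter D i n' (s + c)) ≤ 2 * K * B * l₂ ^ n' * N i (s + c) := by
    rw [map_add]
    refine (map_add_le_add _ _ _).trans ?_
    have a1 : N (i + n') (cocycleIter D i n' s) ≤ K * l₂ ^ n' * (B * N i (s + c)) :=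
      (h.s_le i n' s hs).trans (by gcongr; exact (h₁.trans_le h₁₂).le)
    have a2 : N (i + n') (cocycleIter D i n' c) ≤ K * l₂ ^ n' * (B * N i (s + c)) :=
      (hgc n').1.trans (by gcongr)
    linarith
  obtain ⟨hscB, huB⟩ := H' (N i) (N (i + n')) (cocycleIter D i n') (s + c) u
    (fun v => (cocycleIter_le hK0.le h.map_le i n' v).trans (by gcongr)) hsc
    (le_trans (by gcongr) (h.u_ge i n' u hu))
  have h0 := apply_nonneg (N i) (s + c + u)
  refine ⟨hsB.trans ?_, hcB.trans ?_, huB.trans ?_⟩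
  · rw [mul_assoc]
    gcongr
  · rw [mul_assoc]
    gcongr
  · gcongr
    nlinarith

end Cocycle

/-! ### Weights -/

/-- Auxiliary rates: `κ` and `μ` are the rates of the two weights of `orbitWeight`, and `ρ` is a
common bound for all ratios of rates that must be less than one. -/
theorem exists_weight_rates {ls l₁ l₂ lu r : ℝ} (hls : 0 < ls) (hls1 : ls < 1) (hlu : 1 < lu)
    (h₁ : ls < l₁) (h₁₂ : l₁ ≤ l₂) (h₂ : l₂ < lu) (hr : 0 < r) :
    ∃ κ μ ρ : ℝ, 1 < κ ∧ 1 < μ ∧ 0 < ρ ∧ ρ < 1 ∧ ls ≤ ρ ∧ ls ≤ ρ * l₁ ∧ 1 ≤ ρ * κ ∧ 1 ≤ ρ * μ ∧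
      l₂ ≤ ρ * μ ∧ l₂ * κ ≤ ρ * lu ∧ μ ≤ ρ * lu ∧ κ * Real.exp (-r) ≤ ρ := by
  have hl₁ : 0 < l₁ := hls.trans h₁
  have hl₂ : 0 < l₂ := hl₁.trans_le h₁₂
  obtain ⟨κ, hκ1, hκ⟩ := exists_between (show 1 < min (lu / l₂) (Real.exp r) from
    lt_min ((one_lt_div hl₂).2 h₂) (Real.one_lt_exp_iff.2 hr))
  obtain ⟨μ, hμ1, hμ⟩ := exists_between (max_lt hlu h₂)
  have hκ2 : κ * l₂ < lu := (lt_div_iff₀ hl₂).1 (hκ.trans_le (min_le_left _ _))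
  have hκ3 : κ * Real.exp (-r) < 1 := by
    rw [Real.exp_neg, ← div_eq_mul_inv, div_lt_one (Real.exp_pos r)]
    exact hκ.trans_le (min_le_right _ _)
  have hμ0 : 1 < μ := (le_max_left _ _).trans_lt hμ1
  have hμ2 : l₂ < μ := (le_max_right _ _).trans_lt hμ1
  have hlu0 : 0 < lu := by linarith
  have hκ0 : 0 < κ := by linarith
  have hμ00 : 0 < μ := by linarith
  let T : Finset ℝ := {ls, ls / l₁, 1 / κ, 1 / μ, l₂ / μ, l₂ * κ / lu, μ / lu, κ * Real.exp (-r)}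
  have hT : T.Nonempty := ⟨ls, by simp [T]⟩
  have hle : ∀ t ∈ T, t ≤ T.max' hT := fun t ht => T.le_max' t ht
  have hlt : T.max' hT < 1 := by
    rw [Finset.max'_lt_iff]
    simp only [T, Finset.mem_insert, Finset.mem_singleton, forall_eq_or_imp, forall_eq]
    refine ⟨hls1, (div_lt_one hl₁).2 h₁, (div_lt_one hκ0).2 hκ1, (div_lt_one hμ00).2 hμ0,
      (div_lt_one hμ00).2 hμ2, (div_lt_one hlu0).2 (by linarith), (div_lt_one hlu0).2 hμ, hκ3⟩
  refine ⟨κ, μ, T.max' hT, hκ1, hμ0, hls.trans_le (hle _ (by simp [T])), hlt, hle _ (by simp [T]),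
    ?_, ?_, ?_, ?_, ?_, ?_, hle _ (by simp [T])⟩
  · exact (div_le_iff₀ hl₁).1 (hle _ (by simp [T]))
  · exact (div_le_iff₀ hκ0).1 (hle _ (by simp [T]))
  · exact (div_le_iff₀ hμ00).1 (hle _ (by simp [T]))
  · exact (div_le_iff₀ hμ00).1 (hle _ (by simp [T]))
  · exact (div_le_iff₀ hlu0).1 (hle _ (by simp [T]))
  · exact (div_le_iff₀ hlu0).1 (hle _ (by simp [T]))

/-! ### Approximate orbits of linear cocycles -/

/-- The expected size at time `j ≤ m` of a perturbed orbit: the first term decays from the initial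
time on, slightly slower than the center growth `A j`, the second one grows towards the final
time `m`, slightly slower than the unstable directions. -/
def orbitWeight (A : ℕ → ℝ) (κ μ : ℝ) (m j : ℕ) : ℝ := A j * κ ^ j + μ⁻¹ ^ (m - j)

section Weights

variable {A : ℕ → ℝ} {K ls l₁ l₂ lu κ μ ρ : ℝ} {m : ℕ}

theorem orbitWeight_pos (hA : ∀ i, 0 < A i) (hκ : 1 < κ) (hμ : 1 < μ) (j : ℕ) :
    0 < orbitWeight A κ μ m j := by
  have := hA j
  unfold orbitWeight
  positivity

theorem inv_pow_sub_mul_pow (hμ : 1 < μ) {j n : ℕ} (h : j + n ≤ m) :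
    μ⁻¹ ^ (m - (j + n)) = μ⁻¹ ^ (m - j) * μ ^ n := by
  have hμ0 : μ ≠ 0 := by positivity
  rw [show m - j = m - (j + n) + n by omega, pow_add, mul_assoc, ← mul_pow, inv_mul_cancel₀ hμ0,
    one_pow, mul_one]

/-- Stable contributions are absorbed by the weight. -/
theorem stable_mul_orbitWeight_le (hA : ∀ i, 0 < A i) (hK : 1 ≤ K)
    (hlow : ∀ i n, K⁻¹ * l₁ ^ n * A i ≤ A (i + n)) (hl₁ : 0 < l₁) (hls : 0 < ls) (hκ : 1 < κ)
    (hμ : 1 < μ) (hρ : 0 < ρ) (h1 : ls ≤ ρ) (h2 : ls ≤ ρ * l₁) {k n : ℕ} (h : k + 1 + n ≤ m) :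
    ls ^ n * orbitWeight A κ μ m k ≤
      (K / l₁ + K + 1) * ρ ^ n * orbitWeight A κ μ m (k + 1 + n) := by
  have hK0 : 0 < K := by linarith
  have hAk := hA k
  have hAj := hA (k + 1 + n)
  have e1 : ls ^ n * A k ≤ K / l₁ * ρ ^ n * A (k + 1 + n) := by
    have a1 := hlow k (n + 1)
    rw [show k + (n + 1) = k + 1 + n by omega] at a1
    have a2 : ls ^ n ≤ ρ ^ n * l₁ ^ n := by
      rw [← mul_pow]
      gcongr
    calc ls ^ n * A k ≤ ρ ^ n * l₁ ^ n * A k := by gcongr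
      _ = K / l₁ * ρ ^ n * (K⁻¹ * l₁ ^ (n + 1) * A k) := by
        rw [pow_succ]
        field_simp
      _ ≤ _ := by gcongr
  have e2 : ls ^ n * (A k * κ ^ k) ≤ K / l₁ * ρ ^ n * (A (k + 1 + n) * κ ^ (k + 1 + n)) := by
    calc _ = ls ^ n * A k * κ ^ k := by ring
      _ ≤ K / l₁ * ρ ^ n * A (k + 1 + n) * κ ^ (k + 1 + n) := by
        gcongr
        · exact hκ.le
        · omega
      _ = _ := by ring
  have e3 : ls ^ n * μ⁻¹ ^ (m - k) ≤ ρ ^ n * μ⁻¹ ^ (m - (k + 1 + n)) := by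
    have : μ⁻¹ ^ (m - k) ≤ μ⁻¹ ^ (m - (k + 1 + n)) :=
      pow_le_pow_of_le_one (by positivity) (inv_le_one_of_one_le₀ hμ.le) (by omega)
    gcongr
  unfold orbitWeight
  have p1 : 0 ≤ K / l₁ * (ρ ^ n * μ⁻¹ ^ (m - (k + 1 + n))) := by positivity
  have p2 : 0 ≤ K * (ρ ^ n * (A (k + 1 + n) * κ ^ (k + 1 + n) + μ⁻¹ ^ (m - (k + 1 + n)))) := by
    positivity
  have p3 : 0 ≤ ρ ^ n * (A (k + 1 + n) * κ ^ (k + 1 + n)) := by positivity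
  linarith

/-- Center contributions are absorbed by the weight: those of the first term because `κ > 1`, those
of the second one by domination of the center by the unstable directions. -/
theorem center_mul_orbitWeight_le (hA : ∀ i, 0 < A i) (hK : 1 ≤ K)
    (hlow : ∀ i n, K⁻¹ * l₁ ^ n * A i ≤ A (i + n)) (hup : ∀ i n, A (i + n) ≤ K * l₂ ^ n * A i)
    (hl₁ : 0 < l₁) (hl₂ : 0 < l₂) (hκ : 1 < κ) (hμ : 1 < μ) (hρ : 0 < ρ) (h1 : 1 ≤ ρ * κ)
    (h2 : l₂ ≤ ρ * μ) {k n : ℕ} (h : k + 1 + n ≤ m) :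
    A (k + 1 + n) / A (k + 1) * orbitWeight A κ μ m k ≤
      (K / l₁ + K + 1) * ρ ^ n * orbitWeight A κ μ m (k + 1 + n) := by
  have hK0 : 0 < K := by linarith
  have hAk := hA k
  have hAk1 := hA (k + 1)
  have hAj := hA (k + 1 + n)
  have e1 : A k / A (k + 1) ≤ K / l₁ := by
    rw [div_le_div_iff₀ hAk1 hl₁]
    calc A k * l₁ = K * (K⁻¹ * l₁ ^ 1 * A k) := by
          field_simp
      _ ≤ K * A (k + 1) := by
        gcongr
        exact hlow k 1
  have e2 : κ ^ k ≤ ρ ^ n * κ ^ (k + 1 + n) := by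
    calc κ ^ k = 1 ^ n * κ ^ k := by simp
      _ ≤ (ρ * κ) ^ n * κ ^ (k + 1) := by
        gcongr
        · exact hκ.le
        · omega
      _ = _ := by ring
  have e3 : A (k + 1 + n) / A (k + 1) * (A k * κ ^ k) ≤
      K / l₁ * ρ ^ n * (A (k + 1 + n) * κ ^ (k + 1 + n)) := by
    calc _ = A (k + 1 + n) * (A k / A (k + 1)) * κ ^ k := by ring
      _ ≤ A (k + 1 + n) * (K / l₁) * (ρ ^ n * κ ^ (k + 1 + n)) := by gcongr
      _ = _ := by ring
  have e4 : A (k + 1 + n) / A (k + 1) * μ⁻¹ ^ (m - k) ≤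
      K * ρ ^ n * μ⁻¹ ^ (m - (k + 1 + n)) := by
    have a1 : A (k + 1 + n) / A (k + 1) ≤ K * l₂ ^ n := by
      rw [div_le_iff₀ hAk1]
      exact hup _ _
    have a2 : l₂ ^ n * μ⁻¹ ^ (m - k) ≤ ρ ^ n * μ⁻¹ ^ (m - (k + 1 + n)) := by
      rw [show m - k = n + (m - (k + 1 + n)) + 1 by omega, pow_succ, pow_add]
      have b1 : l₂ ^ n * μ⁻¹ ^ n ≤ ρ ^ n := by
        rw [← mul_pow]
        gcongr
        rwa [← div_eq_mul_inv, div_le_iff₀ (by positivity)]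
      have b2 : μ⁻¹ ≤ 1 := inv_le_one_of_one_le₀ hμ.le
      calc _ = l₂ ^ n * μ⁻¹ ^ n * μ⁻¹ ^ (m - (k + 1 + n)) * μ⁻¹ := by ring
        _ ≤ ρ ^ n * μ⁻¹ ^ (m - (k + 1 + n)) * 1 := by gcongr
        _ = _ := by ring
    calc _ ≤ K * l₂ ^ n * μ⁻¹ ^ (m - k) := by gcongr
      _ = K * (l₂ ^ n * μ⁻¹ ^ (m - k)) := by ring
      _ ≤ K * (ρ ^ n * μ⁻¹ ^ (m - (k + 1 + n))) := by gcongr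
      _ = _ := by ring
  unfold orbitWeight
  have p1 : 0 ≤ K / l₁ * (ρ ^ n * μ⁻¹ ^ (m - (k + 1 + n))) := by positivity
  have p2 : 0 ≤ K * (ρ ^ n * (A (k + 1 + n) * κ ^ (k + 1 + n))) := by positivity
  have p3 : 0 ≤ ρ ^ n * (A (k + 1 + n) * κ ^ (k + 1 + n) + μ⁻¹ ^ (m - (k + 1 + n))) := by
    positivity
  linarith

/-- Unstable contributions, pulled back from later times, are absorbed by the weight. -/
theorem unstable_mul_orbitWeight_le (hA : ∀ i, 0 < A i) (hK : 1 ≤ K)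
    (hup : ∀ i n, A (i + n) ≤ K * l₂ ^ n * A i) (hl₁ : 0 < l₁) (hl₂ : 0 < l₂) (hlu : 1 < lu)
    (hκ : 1 < κ) (hμ : 1 < μ) (hρ : 0 < ρ) (h1 : l₂ * κ ≤ ρ * lu) (h2 : μ ≤ ρ * lu) {j n : ℕ}
    (h : j + n ≤ m) :
    lu⁻¹ ^ (n + 1) * orbitWeight A κ μ m (j + n) ≤
      (K / l₁ + K + 1) * ρ ^ n * orbitWeight A κ μ m j := by
  have hK0 : 0 < K := by linarith
  have hAj := hA j
  have hlu0 : 0 < lu := by linarith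
  have hAn := hA (j + n)
  have q : lu⁻¹ ^ (n + 1) ≤ lu⁻¹ ^ n :=
    pow_le_pow_of_le_one (by positivity) (inv_le_one_of_one_le₀ hlu.le) (by omega)
  have e1 : lu⁻¹ ^ n * (A (j + n) * κ ^ (j + n)) ≤ K * ρ ^ n * (A j * κ ^ j) := by
    have a1 : lu⁻¹ ^ n * (l₂ * κ) ^ n ≤ ρ ^ n := by
      rw [← mul_pow]
      gcongr
      rwa [mul_comm, ← div_eq_mul_inv, div_le_iff₀ hlu0]
    calc _ ≤ lu⁻¹ ^ n * (K * l₂ ^ n * A j * κ ^ (j + n)) := by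
          gcongr
          exact hup j n
      _ = K * (lu⁻¹ ^ n * (l₂ * κ) ^ n) * (A j * κ ^ j) := by ring
      _ ≤ _ := by gcongr
  have e2 : lu⁻¹ ^ n * μ⁻¹ ^ (m - (j + n)) ≤ ρ ^ n * μ⁻¹ ^ (m - j) := by
    rw [inv_pow_sub_mul_pow hμ h]
    have a1 : lu⁻¹ ^ n * μ ^ n ≤ ρ ^ n := by
      rw [← mul_pow]
      gcongr
      rwa [mul_comm, ← div_eq_mul_inv, div_le_iff₀ hlu0]
    calc _ = lu⁻¹ ^ n * μ ^ n * μ⁻¹ ^ (m - j) := by ring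
      _ ≤ _ := by gcongr
  refine (mul_le_mul_of_nonneg_right q (orbitWeight_pos hA hκ hμ _).le).trans ?_
  unfold orbitWeight
  have p1 : 0 ≤ K / l₁ * (ρ ^ n * (A j * κ ^ j + μ⁻¹ ^ (m - j))) := by positivity
  have p2 : 0 ≤ K * (ρ ^ n * μ⁻¹ ^ (m - j)) := by positivity
  have p3 : 0 ≤ ρ ^ n * (A j * κ ^ j) := by positivity
  linarith

theorem sum_geom_le {ρ : ℝ} (hρ : 0 < ρ) (hρ1 : ρ < 1) (n : ℕ) :
    ∑ k ∈ Finset.range n, ρ ^ k ≤ 1 / (1 - ρ) := by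
  rw [one_div, ← tsum_geometric_of_lt_one hρ.le hρ1]
  exact (summable_geometric_of_lt_one hρ.le hρ1).sum_le_tsum _ fun _ _ => by positivity

/-- A sum over the past, with terms of size `b k` at time `k` and kernel `g`, is bounded by the
weight `W` as soon as `b ≤ Q W` and each term of the kernel is absorbed with a geometric gain. -/
theorem sum_past_le {g b W : ℕ → ℝ} {G Q : ℝ} {ρ : ℝ} (hρ : 0 < ρ) (hρ1 : ρ < 1) (hG : 0 ≤ G)
    (hQ : 0 ≤ Q) {j : ℕ} (hω : 0 ≤ W j) (hg : ∀ k < j, 0 ≤ g k) (hb : ∀ k < j, b k ≤ Q * W k)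
    (h : ∀ k n, k + 1 + n = j → g k * W k ≤ G * ρ ^ n * W j) :
    ∑ k ∈ Finset.range j, g k * b k ≤ Q * G / (1 - ρ) * W j := by
  calc ∑ k ∈ Finset.range j, g k * b k
      ≤ ∑ k ∈ Finset.range j, Q * G * W j * ρ ^ (j - 1 - k) := by
        refine Finset.sum_le_sum fun k hk => ?_
        have hk := Finset.mem_range.1 hk
        calc g k * b k ≤ g k * (Q * W k) := mul_le_mul_of_nonneg_left (hb k hk) (hg k hk)
          _ = Q * (g k * W k) := by ring
          _ ≤ Q * (G * ρ ^ (j - 1 - k) * W j) :=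
            mul_le_mul_of_nonneg_left (h k (j - 1 - k) (by omega)) hQ
          _ = _ := by ring
    _ = Q * G * W j * ∑ k ∈ Finset.range j, ρ ^ k := by
        rw [← Finset.mul_sum, Finset.sum_range_reflect (fun k => ρ ^ k) j]
    _ ≤ Q * G * W j * (1 / (1 - ρ)) := by
        gcongr
        exact sum_geom_le hρ hρ1 j
    _ = _ := by ring

end Weights

section Cocycle

variable {E : Type*} [AddCommGroup E] [Module ℝ E]

/-- The a priori estimate behind `exists_approximate_orbit_bound`: if a perturbed orbit is bounded by
`Q` times the weight, then it is bounded by `H (1 + η Q)` times the weight. -/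
theorem IsPartiallyHyperbolicCocycle.exists_bootstrap {K ls l₁ l₂ lu κ μ ρ : ℝ} (hK : 1 ≤ K)
    (hls : 0 < ls) (hlu : 1 < lu) (h₁ : ls < l₁) (h₁₂ : l₁ ≤ l₂) (h₂ : l₂ < lu) (hκ : 1 < κ)
    (hμ : 1 < μ) (hρ : 0 < ρ) (hρ1 : ρ < 1) (c1 : ls ≤ ρ) (c2 : ls ≤ ρ * l₁) (c3 : 1 ≤ ρ * κ)
    (c4 : l₂ ≤ ρ * μ) (c5 : l₂ * κ ≤ ρ * lu) (c6 : μ ≤ ρ * lu) :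
    ∃ H : ℝ, 0 < H ∧ ∀ (N : ℕ → Seminorm ℝ E) (D : ℕ → E →ₗ[ℝ] E) (S C U : ℕ → Submodule ℝ E)
      (A : ℕ → ℝ), IsPartiallyHyperbolicCocycle N D S C U A K ls l₁ l₂ lu →
      ∀ (m : ℕ) (v : ℕ → E) (η Q : ℝ), 0 ≤ η → 0 ≤ Q →
        (∀ i < m, N (i + 1) (v (i + 1) - D i (v i)) ≤ η * N i (v i)) →
        N 0 (v 0) ≤ 1 → N m (v m) ≤ 1 → (∀ j ≤ m, N j (v j) ≤ Q * orbitWeight A κ μ m j) →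
        ∀ j ≤ m, N j (v j) ≤ H * (1 + η * Q) * orbitWeight A κ μ m j := by
  obtain ⟨B, hB, HB⟩ := exists_decomp_bound (E := E) hK hls h₁ h₁₂ h₂
  have hl₁ : 0 < l₁ := hls.trans h₁
  have hl₂ : 0 < l₂ := hl₁.trans_le h₁₂
  have hK0 : 0 < K := by linarith
  have hlu0 : 0 < lu := by linarith
  have hρ1' : 0 < 1 - ρ := by linarith
  set G : ℝ := K / l₁ + K + 1 with hGdef
  have hG : 0 < G := by positivity
  refine ⟨3 * (K * B * G / (1 - ρ)), by positivity,
    fun N D S C U A h m v η Q hη hQ hv hv0 hvm hvQ j hj => ?_⟩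
  have hω : ∀ j, 0 < orbitWeight A κ μ m j := orbitWeight_pos h.growth_pos hκ hμ
  set W := orbitWeight A κ μ m with hωdef
  -- Decompose the initial vector and all errors, and let the three components evolve separately.
  choose es hes ec hec eu heu he using
    fun i => h.exists_decomp (i + 1) (v (i + 1) - D i (v i))
  obtain ⟨s0, hs0, c0, hc0, u0, hu0, hv0'⟩ := h.exists_decomp 0 (v 0)
  let s : ℕ → E := fun j => Nat.rec s0 (fun i x => D i x + es i) j
  let c : ℕ → E := fun j => Nat.rec c0 (fun i x => D i x + ec i) j
  let u : ℕ → E := fun j => Nat.rec u0 (fun i x => D i x + eu i) j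
  have hs : ∀ i, s (i + 1) = D i (s i) + es i := fun i => rfl
  have hc : ∀ i, c (i + 1) = D i (c i) + ec i := fun i => rfl
  have hu : ∀ i, u (i + 1) = D i (u i) + eu i := fun i => rfl
  have hmem : ∀ j, s j ∈ S j ∧ c j ∈ C j ∧ u j ∈ U j := fun j => by
    induction j with
    | zero => exact ⟨hs0, hc0, hu0⟩
    | succ j ih =>
      rw [hs, hc, hu]
      exact ⟨add_mem (h.map_s _ _ ih.1) (hes j), add_mem (h.map_c _ _ ih.2.1) (hec j),
        add_mem (h.map_u _ _ ih.2.2) (heu j)⟩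
  have hdec : ∀ j, v j = s j + c j + u j := fun j => by
    induction j with
    | zero => exact hv0'
    | succ j ih =>
      have e1 : v (j + 1) = D j (v j) + (es j + ec j + eu j) := by rw [← he]; abel
      rw [hs, hc, hu, e1, ih, map_add, map_add]
      abel
  have herr : ∀ i < m, N (i + 1) (es i) ≤ B * η * (Q * W i) ∧
      N (i + 1) (ec i) ≤ B * η * (Q * W i) ∧ N (i + 1) (eu i) ≤ B * η * (Q * W i) := by
    intro i hi
    have hb := HB N D S C U A h (i + 1) _ (hes i) _ (hec i) _ (heu i)
    rw [← he] at hb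
    have hle : B * N (i + 1) (v (i + 1) - D i (v i)) ≤ B * η * (Q * W i) := by
      rw [mul_assoc]
      gcongr
      exact (hv i hi).trans (by gcongr; exact hvQ i hi.le)
    exact ⟨hb.1.trans hle, hb.2.1.trans hle, hb.2.2.trans hle⟩
  have hinit : N 0 s0 ≤ B ∧ N 0 c0 ≤ B ∧ N m (u m) ≤ B := by
    have hb := HB N D S C U A h 0 _ hs0 _ hc0 _ hu0
    have hb' := HB N D S C U A h m _ (hmem m).1 _ (hmem m).2.1 _ (hmem m).2.2
    rw [← hv0'] at hb
    rw [← hdec] at hb'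
    have e1 : B * N 0 (v 0) ≤ B := by nlinarith
    have e2 : B * N m (v m) ≤ B := by nlinarith
    exact ⟨hb.1.trans e1, hb.2.1.trans e1, hb'.2.2.trans e2⟩
  -- Each of the three components is bounded by `X`; in `hsplit`, the first term is the contribution of
  -- the end point, the second one that of the errors.
  set X : ℝ := K * B * G / (1 - ρ) * (1 + η * Q) * W j with hX
  have hsplit : K * B * G * W j + K * (B * η * Q * G / (1 - ρ) * W j) ≤ X := by
    have e1 : K * B * G * W j ≤ K * B * G / (1 - ρ) * W j := by
      have := hω j
      gcongr
      rw [le_div_iff₀ hρ1']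
      nlinarith [show 0 < K * B * G by positivity]
    calc _ ≤ K * B * G / (1 - ρ) * W j + K * (B * η * Q * G / (1 - ρ) * W j) := by gcongr
      _ = X := by
        rw [hX]
        ring
  have hAj : A j ≤ W j := by
    have h1 : A j ≤ A j * κ ^ j :=
      le_mul_of_one_le_right (h.growth_pos j).le (one_le_pow₀ hκ.le)
    have h2 : 0 < μ⁻¹ ^ (m - j) := by positivity
    rw [hωdef, orbitWeight]
    linarith
  have hKG : K ≤ G := by
    have : 0 < K / l₁ := by positivity
    linarith
  have hsX : N j (s j) ≤ X := by
    have h1 := seminorm_le_of_growth_le (g := fun _ n => K * ls ^ n) h.s_le (p := s) hs0 hes hs j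
    refine h1.trans (le_trans (add_le_add ?_ ?_) hsplit)
    · have h3 : ls ^ j ≤ K * W j := by
        have h4 := h.le_growth 0 j
        rw [h.growth_zero, zero_add, mul_one, inv_mul_le_iff₀ hK0] at h4
        have h5 : ls ^ j ≤ l₁ ^ j := by gcongr
        exact h5.trans (h4.trans (by gcongr))
      calc K * ls ^ j * N 0 (s 0) ≤ K * (K * W j) * B := by
            gcongr
            · have := hω j
              positivity
            · exact hinit.1
        _ ≤ K * (G * W j) * B := by
            have := hω j
            gcongr
        _ = _ := by ring
    · simp only [mul_assoc, ← Finset.mul_sum]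
      gcongr
      have := sum_past_le (g := fun k => ls ^ (j - 1 - k)) (b := fun k => N (k + 1) (es k))
        (W := W) (Q := B * η * Q) hρ hρ1 hG.le (by positivity) (hω j).le (fun k _ => by positivity)
        (fun k hk => by
          rw [mul_assoc (B * η)]
          exact (herr k (by omega)).1)
        (fun k n hkn => by
          subst hkn
          rw [show k + 1 + n - 1 - k = n by omega]
          exact stable_mul_orbitWeight_le h.growth_pos hK h.le_growth hl₁ hls hκ hμ hρ c1 c2 hj)
      simpa only [mul_assoc] using this
  have hcX : N j (c j) ≤ X := by
    have h1 := seminorm_le_of_growth_le (g := fun i n => A (i + n) / A i) (fun i n w hw => (h.c_eq i n w hw).le) (p := c)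
      hc0 hec hc j
    refine h1.trans (le_trans (add_le_add ?_ ?_) hsplit)
    · rw [h.growth_zero, zero_add, div_one]
      calc A j * N 0 (c 0) ≤ W j * B := by
            gcongr
            · exact (hω j).le
            · exact hinit.2.1
        _ = 1 * B * 1 * W j := by ring
        _ ≤ K * B * G * W j := by
            have := hω j
            gcongr
            linarith
    · have := sum_past_le (g := fun k => A (k + 1 + (j - 1 - k)) / A (k + 1))
        (b := fun k => N (k + 1) (ec k))
        (W := W) (Q := B * η * Q) hρ hρ1 hG.le (by positivity) (hω j).le
        (fun k _ => (div_pos (h.growth_pos _) (h.growth_pos _)).le)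
        (fun k hk => by
          rw [mul_assoc (B * η)]
          exact (herr k (by omega)).2.1)
        (fun k n hkn => by
          subst hkn
          rw [show k + 1 + n - 1 - k = n by omega]
          exact center_mul_orbitWeight_le h.growth_pos hK h.le_growth h.growth_le hl₁ hl₂ hκ hμ hρ
            c3 c4 hj)
      refine this.trans (le_mul_of_one_le_left ?_ hK)
      have := hω j
      positivity
  have huX : N j (u j) ≤ X := by
    have hg : ∀ i n, ∀ w ∈ U i, N i w ≤ K * lu⁻¹ ^ n * N (i + n) (cocycleIter D i n w) := by
      intro i n w hw
      have := h.u_ge i n w hw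
      calc N i w = K * lu⁻¹ ^ n * (K⁻¹ * lu ^ n * N i w) := by
            rw [inv_pow]
            field_simp
        _ ≤ _ := by gcongr
    have h1 := seminorm_le_of_expanding (g := fun n => K * lu⁻¹ ^ n) hg h.map_u h.surj_u (p := u)
      hu0 heu hu j (m - j)
    rw [show j + (m - j) = m by omega] at h1
    refine h1.trans (le_trans (add_le_add ?_ ?_) hsplit)
    · have h3 : lu⁻¹ ^ (m - j) ≤ W j := by
        have h4 : lu⁻¹ ^ (m - j) ≤ μ⁻¹ ^ (m - j) := by
          gcongr
          nlinarith
        have h5 : 0 < A j * κ ^ j := mul_pos (h.growth_pos j) (by positivity)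
        rw [hωdef, orbitWeight]
        linarith
      calc K * lu⁻¹ ^ (m - j) * N m (u m) ≤ K * W j * B := by
            gcongr
            · have := hω j
              positivity
            · exact hinit.2.2
        _ = K * B * 1 * W j := by ring
        _ ≤ _ := by
            have := hω j
            gcongr
            linarith
    · calc _ ≤ ∑ k ∈ Finset.range (m - j), K * (B * η * Q * G * W j) * ρ ^ k := by
            refine Finset.sum_le_sum fun k hk => ?_
            have hk := Finset.mem_range.1 hk
            calc _ ≤ K * lu⁻¹ ^ (k + 1) * (B * η * (Q * W (j + k))) := by
                  gcongr
                  exact (herr (j + k) (by omega)).2.2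
              _ = K * (B * η * Q) * (lu⁻¹ ^ (k + 1) * W (j + k)) := by ring
              _ ≤ K * (B * η * Q) * (G * ρ ^ k * W j) :=
                  mul_le_mul_of_nonneg_left (unstable_mul_orbitWeight_le h.growth_pos hK
                    h.growth_le hl₁ hl₂ hlu hκ hμ hρ c5 c6 (by omega)) (by positivity)
              _ = _ := by ring
        _ = K * (B * η * Q * G * W j) * ∑ k ∈ Finset.range (m - j), ρ ^ k := by
            rw [← Finset.mul_sum]
        _ ≤ K * (B * η * Q * G * W j) * (1 / (1 - ρ)) := by
            have := hω j
            gcongr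
            exact sum_geom_le hρ hρ1 _
        _ = _ := by ring
  calc N j (v j) = N j (s j + c j + u j) := by rw [← hdec]
    _ ≤ N j (s j) + N j (c j) + N j (u j) :=
      (map_add_le_add _ _ _).trans (add_le_add_left (map_add_le_add _ _ _) _)
    _ ≤ X + X + X := by gcongr
    _ = _ := by
      rw [hX]
      ring

/-- Approximate orbits, of length `m`, of a partially hyperbolic cocycle with contracting center are
exponentially small away from the two ends of the time interval. -/
theorem IsPartiallyHyperbolicCocycle.exists_approximate_orbit_bound {K ls l₁ l₂ lu r : ℝ}
    (hK : 1 ≤ K) (hls : 0 < ls) (hls1 : ls < 1) (hlu : 1 < lu) (h₁ : ls < l₁) (h₁₂ : l₁ ≤ l₂)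
    (h₂ : l₂ < lu) (hr : 0 < r) :
    ∃ η B ρ : ℝ, 0 < η ∧ 0 < B ∧ 0 < ρ ∧ ρ < 1 ∧ ∀ (N : ℕ → Seminorm ℝ E) (D : ℕ → E →ₗ[ℝ] E)
      (S C U : ℕ → Submodule ℝ E) (A : ℕ → ℝ),
      IsPartiallyHyperbolicCocycle N D S C U A K ls l₁ l₂ lu →
      ∀ (m : ℕ) (v : ℕ → E), (∀ j ≤ m, A j ≤ Real.exp (-r) ^ j) →
        (∀ i < m, N (i + 1) (v (i + 1) - D i (v i)) ≤ η * N i (v i)) →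
        N 0 (v 0) ≤ 1 → N m (v m) ≤ 1 → ∀ j ≤ m, N j (v j) ≤ B * (ρ ^ j + ρ ^ (m - j)) := by
  obtain ⟨κ, μ, ρ, hκ, hμ, hρ, hρ1, c1, c2, c3, c3', c4, c5, c6, c7⟩ :=
    exists_weight_rates hls hls1 hlu h₁ h₁₂ h₂ hr
  obtain ⟨H, hH, hboot⟩ := exists_bootstrap (E := E) hK hls hlu h₁ h₁₂ h₂ hκ hμ hρ hρ1 c1 c2 c3 c4
    c5 c6
  refine ⟨1 / (2 * H), 2 * H, ρ, by positivity, by positivity, hρ, hρ1,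
    fun N D S C U A h m v hA hv hv0 hvm j hj => ?_⟩
  have hω : ∀ j, 0 < orbitWeight A κ μ m j := orbitWeight_pos h.growth_pos hκ hμ
  obtain ⟨j₀, hj₀, hmax⟩ := Finset.exists_max_image (Finset.range (m + 1))
    (fun j => N j (v j) / orbitWeight A κ μ m j) ⟨0, by simp⟩
  set Q := N j₀ (v j₀) / orbitWeight A κ μ m j₀ with hQ
  have hQ0 : 0 ≤ Q := div_nonneg (apply_nonneg _ _) (hω _).le
  have hle : ∀ j ≤ m, N j (v j) ≤ Q * orbitWeight A κ μ m j := fun j hj =>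
    (div_le_iff₀ (hω j)).1 (hmax j (Finset.mem_range.2 (by omega)))
  -- The bootstrap improves the optimal constant `Q`, unless `Q ≤ 2 H`.
  have hQH : Q ≤ 2 * H := by
    have h1 := hboot N D S C U A h m v _ Q (by positivity) hQ0 hv hv0 hvm hle j₀
      (by have := Finset.mem_range.1 hj₀; omega)
    rw [← div_le_iff₀ (hω j₀), ← hQ] at h1
    have h2 : H * (1 + 1 / (2 * H) * Q) = H + Q / 2 := by field_simp
    linarith
  have hωle : orbitWeight A κ μ m j ≤ ρ ^ j + ρ ^ (m - j) := by
    unfold orbitWeight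
    refine add_le_add ?_ ?_
    · calc A j * κ ^ j ≤ Real.exp (-r) ^ j * κ ^ j := by
            gcongr
            exact hA j hj
        _ = (κ * Real.exp (-r)) ^ j := by rw [← mul_pow, mul_comm]
        _ ≤ ρ ^ j := by gcongr
    · gcongr
      rw [inv_le_iff_one_le_mul₀ (by positivity)]
      exact c3'
  calc N j (v j) ≤ Q * orbitWeight A κ μ m j := hle j hj
    _ ≤ 2 * H * (ρ ^ j + ρ ^ (m - j)) := by
      gcongr
      exact (hω j).le

end Cocycle

/-! ### The derivative cocycle along an orbit -/

theorem proj_shift_iterate_add {M : Type*} {f : M → M} (x : InverseLimit f) (i n : ℕ) :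
    f^[n] (proj f ((shift f)^[i] x)) = proj f ((shift f)^[i + n] x) := by
  induction n with
  | zero => rfl
  | succ n ih =>
    rw [Function.iterate_succ_apply', ih, ← add_assoc, Function.iterate_succ_apply']
    exact ((shift f)^[i + n] x).2 0

theorem dist_proj_le_orbitDist {M : Type*} [MetricSpace M] [CompactSpace M] {f : M → M}
    (x y : InverseLimit f) : dist (proj f x) (proj f y) ≤ orbitDist f x y := by
  have hs : Summable fun n : ℤ => (1 / 2 : ℝ) ^ n.natAbs * Metric.diam (univ : Set M) := by
    refine Summable.mul_right _ (Summable.of_nat_of_neg ?_ ?_) <;>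
      simpa using summable_geometric_two
  have hs' : Summable fun n : ℤ => (1 / 2 : ℝ) ^ n.natAbs * dist (x.1 n) (y.1 n) := by
    refine hs.of_nonneg_of_le (fun n => by positivity) fun n => ?_
    gcongr
    exact Metric.dist_le_diam_of_mem isCompact_univ.isBounded (mem_univ _) (mem_univ _)
  simpa [proj, orbitDist] using hs'.le_tsum 0 fun n _ => by positivity

section Orbit

variable {E : Type*} [NormedAddCommGroup E] [NormedSpace ℝ E]
  {M : Type*} [MetricSpace M] [ChartedSpace E M]

/-- The fibre of a family of subspaces, as a subspace of the model space `E`. -/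
def modelFiber {f : M → M} (V : SubspaceFamily (E := E) f) (x : InverseLimit f) : Submodule ℝ E :=
  V x

theorem nontrivial_modelFiber {f : M → M} (V : SubspaceFamily (E := E) f) (x : InverseLimit f)
    (h : Module.finrank ℝ (V x) = 1) : Nontrivial (modelFiber V x) :=
  Module.nontrivial_of_finrank_pos (R := ℝ) (M := V x) (by rw [h]; exact one_pos)

theorem cocycleIter_tanDeriv {f : M → M} (hf : MDifferentiable 𝓘(ℝ, E) 𝓘(ℝ, E) f)
    (x : InverseLimit f) (i n : ℕ) :
    cocycleIter (fun i => (tanDeriv E f (proj f ((shift f)^[i] x)) : E →ₗ[ℝ] E)) i n =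
      tanDeriv E f^[n] (proj f ((shift f)^[i] x)) := by
  induction n with
  | zero =>
    have h : tanDeriv E f^[0] (proj f ((shift f)^[i] x)) = ContinuousLinearMap.id ℝ E := mfderiv_id
    rw [h]
    rfl
  | succ n ih =>
    have hn : ∀ n, MDifferentiable 𝓘(ℝ, E) 𝓘(ℝ, E) f^[n] := fun n => by
      induction n with
      | zero => exact mdifferentiable_id
      | succ n ih => exact ih.comp hf
    rw [Function.iterate_succ', tanDeriv_comp (hn n _) (hf _), proj_shift_iterate_add]
    ext v
    rw [cocycleIter_succ_apply, ih]
    rfl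

theorem IsInvariantFamily.tanDeriv_mem {f : M → M} {V : SubspaceFamily (E := E) f}
    (hV : IsInvariantFamily V) (x : InverseLimit f) {v : E} (hv : v ∈ modelFiber V x) :
    tanDeriv E f (proj f x) v ∈ modelFiber V (shift f x) := by
  have h : tangentMap 𝓘(ℝ, E) 𝓘(ℝ, E) f ⟨proj f x, v⟩ ∈ fiberSet V (shift f x) := by
    rw [← hV x]
    exact mem_image_of_mem _ ⟨v, hv, rfl⟩
  obtain ⟨w, hw, h⟩ := h
  have h' : tanDeriv E f (proj f x) v = w :=
    congrArg (fun q : TangentBundle 𝓘(ℝ, E) M => (q.2 : E)) h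
  rw [h']
  exact hw

theorem IsInvariantFamily.exists_tanDeriv_eq {f : M → M} {V : SubspaceFamily (E := E) f}
    (hV : IsInvariantFamily V) (x : InverseLimit f) {w : E} (hw : w ∈ modelFiber V (shift f x)) :
    ∃ v ∈ modelFiber V x, tanDeriv E f (proj f x) v = w := by
  have h : (⟨proj f (shift f x), w⟩ : TangentBundle 𝓘(ℝ, E) M) ∈ fiberSet V (shift f x) :=
    ⟨w, hw, rfl⟩
  rw [← hV x] at h
  obtain ⟨-, ⟨v, hv, rfl⟩, h⟩ := h
  exact ⟨v, hv, congrArg (fun q : TangentBundle 𝓘(ℝ, E) M => (q.2 : E)) h⟩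

variable [RiemannianBundle (fun p : M => TangentSpace 𝓘(ℝ, E) p)]

theorem tanNorm_pos (x : M) {v : E} (hv : v ≠ 0) : 0 < tanNorm E x v :=
  (@norm_pos_iff (TangentSpace 𝓘(ℝ, E) x) _ v).2 hv

/-- On a line a linear map multiplies the norm by its operator norm. -/
theorem norm_apply_eq_of_finrank_eq_one {V W : Type*} [NormedAddCommGroup V] [NormedSpace ℝ V]
    [NormedAddCommGroup W] [NormedSpace ℝ W] (h : Module.finrank ℝ V = 1) (L : V →L[ℝ] W) (v : V) :
    ‖L v‖ = ‖L‖ * ‖v‖ := by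
  rcases eq_or_ne v 0 with rfl | hv
  · simp
  refine le_antisymm (L.le_opNorm v) ?_
  rw [← le_div_iff₀ (norm_pos_iff.2 hv)]
  refine L.opNorm_le_bound (by positivity) fun w => ?_
  obtain ⟨c, rfl⟩ := (finrank_eq_one_iff_of_nonzero' v hv).1 h w
  rw [map_smul, norm_smul, norm_smul]
  have := norm_pos_iff.2 hv
  field_simp
  exact le_rfl

/-- `φ̃^c` is the logarithmic rate of the derivative on the center line. -/
theorem tanNorm_tanDeriv_center {f : M → M} {Ec : SubspaceFamily (E := E) f}
    {x : InverseLimit f} (hdim : Module.finrank ℝ (Ec x) = 1) {a : ℝ} (ha : 0 < a)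
    (hlow : ∀ v ∈ modelFiber Ec x, a * tanNorm E (proj f x) v ≤
      tanNorm E (f (proj f x)) (tanDeriv E f (proj f x) v)) {v : E} (hv : v ∈ modelFiber Ec x) :
    tanNorm E (f (proj f x)) (tanDeriv E f (proj f x) v) =
      Real.exp (centralLog Ec x) * tanNorm E (proj f x) v := by
  set L := (mfderiv 𝓘(ℝ, E) 𝓘(ℝ, E) f (proj f x)).comp (Ec x).subtypeL with hL
  have key : ∀ w : Ec x, ‖L w‖ = ‖L‖ * ‖w‖ := norm_apply_eq_of_finrank_eq_one hdim L
  have hpos : 0 < ‖L‖ := by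
    have : Nontrivial (Ec x) :=
      Module.nontrivial_of_finrank_pos (R := ℝ) (by rw [hdim]; exact one_pos)
    obtain ⟨w, hw⟩ := exists_ne (0 : Ec x)
    have h1 : 0 < ‖w‖ := norm_pos_iff.2 hw
    have h2 : a * ‖w‖ ≤ ‖L w‖ := hlow w.1 w.2
    rw [key w] at h2
    exact ha.trans_le (le_of_mul_le_mul_right h2 h1)
  have h := key ⟨v, hv⟩
  rw [centralLog, Real.exp_log hpos]
  exact h

variable [IsManifold 𝓘(ℝ, E) ∞ M]

/-- Along every orbit, the derivative of a partially hyperbolic endomorphism is a partially hyperbolic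
cocycle, with constants that do not depend on the orbit. -/
theorem IsPartiallyHyperbolicSplitting.exists_cocycle {f : M → M}
    (hf : MDifferentiable 𝓘(ℝ, E) 𝓘(ℝ, E) f) {Es Ec Eu : SubspaceFamily (E := E) f}
    (hph : IsPartiallyHyperbolicSplitting f Es Ec Eu) (hdim : ∀ x, Module.finrank ℝ (Ec x) = 1)
    {L : ℝ} (hL : ∀ (x : M) (v : E), tanNorm E (f x) (tanDeriv E f x v) ≤ L * tanNorm E x v) :
    ∃ K ls l₁ l₂ lu : ℝ, 1 ≤ K ∧ 0 < ls ∧ ls < 1 ∧ 1 < lu ∧ ls < l₁ ∧ l₁ ≤ l₂ ∧ l₂ < lu ∧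
      ∀ x : InverseLimit f, IsPartiallyHyperbolicCocycle
        (fun i => tanNorm E (proj f ((shift f)^[i] x)))
        (fun i => (tanDeriv E f (proj f ((shift f)^[i] x)) : E →ₗ[ℝ] E))
        (fun i => modelFiber Es ((shift f)^[i] x)) (fun i => modelFiber Ec ((shift f)^[i] x))
        (fun i => modelFiber Eu ((shift f)^[i] x))
        (fun i => Real.exp (birkhoffSum (shift f) (centralLog Ec) i x)) K ls l₁ l₂ lu := by
  obtain ⟨ls, l₁, l₂, lu, C, hls, hls1, hlu, h₁, h₁₂, h₂, hC, hr⟩ := hph.rates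
  have hl₁ : 0 < l₁ := hls.trans h₁
  have hl₂ : 0 < l₂ := hl₁.trans_le h₁₂
  obtain ⟨K, hK1, hCK, hLK⟩ : ∃ K : ℝ, 1 ≤ K ∧ C ≤ K ∧ L ≤ K := ⟨max 1 (max C L), by simp⟩
  refine ⟨K, ls, l₁, l₂, lu, hK1, hls, hls1, hlu, h₁, h₁₂, h₂, fun x => ?_⟩
  have hK0 : 0 < K := by linarith
  have hmove : ∀ i n, f^[n] (proj f ((shift f)^[i] x)) = proj f ((shift f)^[i + n] x) :=
    proj_shift_iterate_add x
  have hmove1 : ∀ i, f (proj f ((shift f)^[i] x)) = proj f ((shift f)^[i + 1] x) :=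
    fun i => hmove i 1
  have hsucc : ∀ i, (shift f)^[i + 1] x = shift f ((shift f)^[i] x) :=
    fun i => Function.iterate_succ_apply' _ _ _
  have hmapc : ∀ i, ∀ v ∈ modelFiber Ec ((shift f)^[i] x),
      tanDeriv E f (proj f ((shift f)^[i] x)) v ∈ modelFiber Ec ((shift f)^[i + 1] x) := by
    intro i v hv
    rw [hsucc]
    exact hph.invariant_c.tanDeriv_mem _ hv
  -- The rates of the splitting, in terms of the iterates of the cocycle.
  have hrate : ∀ i n,
      (∀ v ∈ modelFiber Es ((shift f)^[i] x), tanNorm E (proj f ((shift f)^[i + n] x))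
          (tanDeriv E f^[n] (proj f ((shift f)^[i] x)) v) ≤
        C * ls ^ n * tanNorm E (proj f ((shift f)^[i] x)) v) ∧
      (∀ v ∈ modelFiber Ec ((shift f)^[i] x),
        C⁻¹ * l₁ ^ n * tanNorm E (proj f ((shift f)^[i] x)) v ≤
          tanNorm E (proj f ((shift f)^[i + n] x))
            (tanDeriv E f^[n] (proj f ((shift f)^[i] x)) v) ∧
        tanNorm E (proj f ((shift f)^[i + n] x))
            (tanDeriv E f^[n] (proj f ((shift f)^[i] x)) v) ≤
          C * l₂ ^ n * tanNorm E (proj f ((shift f)^[i] x)) v) ∧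
      (∀ v ∈ modelFiber Eu ((shift f)^[i] x),
        C⁻¹ * lu ^ n * tanNorm E (proj f ((shift f)^[i] x)) v ≤
          tanNorm E (proj f ((shift f)^[i + n] x))
            (tanDeriv E f^[n] (proj f ((shift f)^[i] x)) v)) := by
    intro i n
    rw [← hmove]
    exact hr ((shift f)^[i] x) n
  have hc1 : ∀ i, ∀ v ∈ modelFiber Ec ((shift f)^[i] x),
      tanNorm E (proj f ((shift f)^[i + 1] x)) (tanDeriv E f (proj f ((shift f)^[i] x)) v) =
        Real.exp (centralLog Ec ((shift f)^[i] x)) * tanNorm E (proj f ((shift f)^[i] x)) v := by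
    intro i v hv
    have h := (hrate i 1).2.1
    rw [← hmove1] at h ⊢
    refine tanNorm_tanDeriv_center (a := C⁻¹ * l₁) (hdim _) (by positivity) (fun w hw => ?_) hv
    simpa using (h w hw).1
  have hceq : ∀ i n, ∀ v ∈ modelFiber Ec ((shift f)^[i] x),
      tanNorm E (proj f ((shift f)^[i + n] x))
        (cocycleIter (fun i => (tanDeriv E f (proj f ((shift f)^[i] x)) : E →ₗ[ℝ] E)) i n v) =
      Real.exp (birkhoffSum (shift f) (centralLog Ec) (i + n) x) /
        Real.exp (birkhoffSum (shift f) (centralLog Ec) i x) *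
        tanNorm E (proj f ((shift f)^[i] x)) v := by
    intro i n v hv
    induction n with
    | zero =>
      simp [cocycleIter]
    | succ n ih =>
      have hm := cocycleIter_mem (P := fun i => modelFiber Ec ((shift f)^[i] x))
        (D := fun i => (tanDeriv E f (proj f ((shift f)^[i] x)) : E →ₗ[ℝ] E)) hmapc i n hv
      rw [cocycleIter_succ_apply, ← add_assoc]
      refine (hc1 _ _ hm).trans ?_
      rw [ih, birkhoffSum_succ, Real.exp_add]
      ring
  have hrc : ∀ i n, K⁻¹ * l₁ ^ n * Real.exp (birkhoffSum (shift f) (centralLog Ec) i x) ≤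
        Real.exp (birkhoffSum (shift f) (centralLog Ec) (i + n) x) ∧
      Real.exp (birkhoffSum (shift f) (centralLog Ec) (i + n) x) ≤
        K * l₂ ^ n * Real.exp (birkhoffSum (shift f) (centralLog Ec) i x) := by
    intro i n
    have : Nontrivial (modelFiber Ec ((shift f)^[i] x)) :=
      nontrivial_modelFiber Ec _ (hdim _)
    obtain ⟨w, hw⟩ := exists_ne (0 : modelFiber Ec ((shift f)^[i] x))
    have hw0 := tanNorm_pos (proj f ((shift f)^[i] x)) (v := (w : E))
      (fun h => hw (Subtype.ext h))
    have h1 := (hrate i n).2.1 w w.2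
    have h2 := hceq i n w w.2
    rw [cocycleIter_tanDeriv hf] at h2
    simp only [ContinuousLinearMap.coe_coe] at h2
    rw [h2] at h1
    have h3 := le_of_mul_le_mul_right h1.1 hw0
    have h4 := le_of_mul_le_mul_right h1.2 hw0
    rw [le_div_iff₀ (Real.exp_pos _)] at h3
    rw [div_le_iff₀ (Real.exp_pos _)] at h4
    exact ⟨le_trans (by gcongr) h3, h4.trans (by gcongr)⟩
  constructor
  · intro i v
    simp only [← hmove1]
    exact (hL _ v).trans (by gcongr)
  · intro i v
    have h : (modelFiber Es ((shift f)^[i] x) ⊔ modelFiber Ec ((shift f)^[i] x)) ⊔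
        modelFiber Eu ((shift f)^[i] x) = ⊤ := (hph.isCompl_scu _).sup_eq_top
    have h : v ∈ (modelFiber Es ((shift f)^[i] x) ⊔ modelFiber Ec ((shift f)^[i] x)) ⊔
        modelFiber Eu ((shift f)^[i] x) := h ▸ Submodule.mem_top
    obtain ⟨sc, hsc, u, hu, h⟩ := Submodule.mem_sup.1 h
    obtain ⟨s, hs, c, hc, rfl⟩ := Submodule.mem_sup.1 hsc
    exact ⟨s, hs, c, hc, u, hu, h.symm⟩
  · intro i v hv
    simp only [hsucc]
    exact hph.invariant_s.tanDeriv_mem _ hv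
  · exact hmapc
  · intro i v hv
    simp only [hsucc]
    exact hph.invariant_u.tanDeriv_mem _ hv
  · intro i w hw
    simp only [hsucc] at hw
    exact hph.invariant_u.exists_tanDeriv_eq _ hw
  · intro i n v hv
    rw [cocycleIter_tanDeriv hf]
    exact ((hrate i n).1 v hv).trans (by gcongr)
  · exact hceq
  · intro i n v hv
    rw [cocycleIter_tanDeriv hf]
    refine le_trans ?_ ((hrate i n).2.2 v hv)
    gcongr
  · simp
  · exact fun i => Real.exp_pos _
  · exact fun i n => (hrc i n).1
  · exact fun i n => (hrc i n).2

end Orbit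

/-! ### Distortion of Hölder functions -/

/-- A Hölder function has bounded distortion along two orbits whose distance at time `i ≤ m` is
exponentially small in the distance of `i` to `{0, m}`. -/
theorem exists_holder_distortion_bound {M : Type*} [MetricSpace M] {φ : M → ℝ} {K α : ℝ≥0}
    (hα : 0 < α) (hφ : HolderWith K α φ) {B ρ : ℝ} (hB : 0 < B) (hρ : 0 < ρ) (hρ1 : ρ < 1) :
    ∃ K' : ℝ, 0 < K' ∧ ∀ (m : ℕ) (p q : ℕ → M),
      (∀ j ≤ m, dist (p j) (q j) ≤ B * (ρ ^ j + ρ ^ (m - j))) →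
      |∑ i ∈ Finset.range (m + 1), φ (p i) - ∑ i ∈ Finset.range (m + 1), φ (q i)| ≤ K' := by
  -- `∑ i ≤ m, (ρ ^ i + ρ ^ (m - i)) ^ α` is at most two geometric series of ratio `σ = ρ ^ α`,
  -- up to the constant `2 ^ α`.
  set σ := ρ ^ (α : ℝ) with hσ
  have hα' : (0 : ℝ) < α := hα
  have hσ0 : 0 < σ := by positivity
  have hσ1 : σ < 1 := Real.rpow_lt_one hρ.le hρ1 hα'
  have h1σ : 0 < 1 - σ := by linarith
  refine ⟨K * (2 * B) ^ (α : ℝ) * (2 / (1 - σ)) + 1, by positivity, fun m p q h => ?_⟩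
  have hterm : ∀ j ≤ m, |φ (p j) - φ (q j)| ≤
      K * (2 * B) ^ (α : ℝ) * (σ ^ j + σ ^ (m - j)) := by
    intro j hj
    have e1 : ∀ k : ℕ, (ρ ^ k) ^ (α : ℝ) = σ ^ k := fun k => by
      rw [hσ, ← Real.rpow_natCast, ← Real.rpow_natCast, ← Real.rpow_mul hρ.le,
        ← Real.rpow_mul hρ.le, mul_comm]
    have e2 : (ρ ^ j + ρ ^ (m - j)) ≤ 2 * max (ρ ^ j) (ρ ^ (m - j)) := by
      linarith [le_max_left (ρ ^ j) (ρ ^ (m - j)), le_max_right (ρ ^ j) (ρ ^ (m - j))]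
    have e3 : (max (ρ ^ j) (ρ ^ (m - j))) ^ (α : ℝ) ≤ σ ^ j + σ ^ (m - j) := by
      rcases max_choice (ρ ^ j) (ρ ^ (m - j)) with h | h <;> rw [h, e1]
      · linarith [show 0 < σ ^ (m - j) by positivity]
      · linarith [show 0 < σ ^ j by positivity]
    rw [← Real.dist_eq]
    calc dist (φ (p j)) (φ (q j)) ≤ K * dist (p j) (q j) ^ (α : ℝ) := hφ.dist_le _ _
      _ ≤ K * (2 * B * max (ρ ^ j) (ρ ^ (m - j))) ^ (α : ℝ) := by
        gcongr
        refine (h j hj).trans ?_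
        calc _ ≤ B * (2 * max (ρ ^ j) (ρ ^ (m - j))) := by gcongr
          _ = _ := by ring
      _ = K * ((2 * B) ^ (α : ℝ) * max (ρ ^ j) (ρ ^ (m - j)) ^ (α : ℝ)) := by
        rw [Real.mul_rpow (by positivity) (by positivity)]
      _ ≤ K * ((2 * B) ^ (α : ℝ) * (σ ^ j + σ ^ (m - j))) := by gcongr
      _ = _ := by ring
  have hgeom := sum_geom_le hσ0 hσ1 (m + 1)
  have hsum : ∑ i ∈ Finset.range (m + 1), (σ ^ i + σ ^ (m - i)) ≤ 2 / (1 - σ) := by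
    have h2 : ∑ i ∈ Finset.range (m + 1), σ ^ (m - i) = ∑ i ∈ Finset.range (m + 1), σ ^ i :=
      Finset.sum_range_reflect (fun k => σ ^ k) (m + 1)
    rw [Finset.sum_add_distrib, h2]
    calc _ ≤ 1 / (1 - σ) + 1 / (1 - σ) := add_le_add hgeom hgeom
      _ = _ := by ring
  rw [← Finset.sum_sub_distrib]
  calc _ ≤ ∑ i ∈ Finset.range (m + 1), |φ (p i) - φ (q i)| := Finset.abs_sum_le_sum_abs _ _
    _ ≤ ∑ i ∈ Finset.range (m + 1), K * (2 * B) ^ (α : ℝ) * (σ ^ i + σ ^ (m - i)) :=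
      Finset.sum_le_sum fun i hi => hterm i (by have := Finset.mem_range.1 hi; omega)
    _ = K * (2 * B) ^ (α : ℝ) * ∑ i ∈ Finset.range (m + 1), (σ ^ i + σ ^ (m - i)) := by
      rw [Finset.mul_sum]
    _ ≤ K * (2 * B) ^ (α : ℝ) * (2 / (1 - σ)) := by gcongr
    _ ≤ _ := by linarith

end PHEndo
end

theorem proposition4p9
    {E : Type*} [NormedAddCommGroup E] [NormedSpace ℝ E] [FiniteDimensional ℝ E]
    {M : Type*} [MetricSpace M] [CompactSpace M] [ChartedSpace E M] [IsManifold 𝓘(ℝ, E) ∞ M]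
    [RiemannianBundle (fun p : M => TangentSpace 𝓘(ℝ, E) p)]
    [IsContMDiffRiemannianBundle 𝓘(ℝ, E) ∞ E (fun p : M => TangentSpace 𝓘(ℝ, E) p)]
    [IsRiemannianManifold 𝓘(ℝ, E) M]
    (f : M → M) (hf : ContMDiff 𝓘(ℝ, E) 𝓘(ℝ, E) 2 f) (hnd : PHEndo.NonDegenerate (E := E) f)
    (Es Ec Eu : PHEndo.SubspaceFamily (E := E) f)
    (hph : PHEndo.IsPartiallyHyperbolicSplitting f Es Ec Eu)
    (hdim : ∀ x, Module.finrank ℝ (Ec x) = 1)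
    (r : ℝ) (hr : 0 < r)
    (φ : M → ℝ) (hφ : ∃ K α : ℝ≥0, 0 < α ∧ HolderWith K α φ) :
    ∃ ε₀ : ℝ, 0 < ε₀ ∧ ∀ ε : ℝ, 0 < ε → ε < ε₀ →
      PHEndo.BowenProperty (PHEndo.orbitDist f) (PHEndo.shift f) (φ ∘ PHEndo.proj f)
        (PHEndo.goodCollection Ec r) ε := by
  have hf1 : ContMDiff 𝓘(ℝ, E) 𝓘(ℝ, E) 1 f := hf.of_le (by norm_num)
  obtain ⟨Kφ, α, hα, hφ⟩ := hφ
  obtain ⟨L, hL, hLf, hdisp⟩ := PHEndo.exists_displacement hf1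
  obtain ⟨K, ls, l₁, l₂, lu, hK, hls, hls1, hlu, h₁, h₁₂, h₂, hcoc⟩ :=
    hph.exists_cocycle (hf1.mdifferentiable one_ne_zero) hdim hLf
  obtain ⟨η, B, ρ, hη, hB, hρ, hρ1, hbound⟩ :=
    PHEndo.IsPartiallyHyperbolicCocycle.exists_approximate_orbit_bound (E := E) hK hls hls1 hlu h₁
      h₁₂ h₂ hr
  obtain ⟨ε₁, hε₁, V, hV⟩ := hdisp η hη
  obtain ⟨K', hK', hdist⟩ := PHEndo.exists_holder_distortion_bound hα hφ (mul_pos hL hB) hρ hρ1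
  refine ⟨min ε₁ L⁻¹, lt_min hε₁ (inv_pos.2 hL), fun ε hε hεε => ⟨K', hK', ?_⟩⟩
  intro x n hx y hy
  -- An orbit segment of length `m + 1` has its last point at time `m`.
  rcases n with _ | m
  · simpa using hK'.le
  have hd : ∀ j ≤ m, dist (PHEndo.proj f ((PHEndo.shift f)^[j] x))
      (PHEndo.proj f ((PHEndo.shift f)^[j] y)) < min ε₁ L⁻¹ := fun j hj =>
    (PHEndo.dist_proj_le_orbitDist _ _).trans_lt ((hy j (by omega)).trans hεε)
  have hd₁ := fun j hj => (hd j hj).trans_le (min_le_left _ _)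
  have hmove : ∀ (z : PHEndo.InverseLimit f) (i : ℕ),
      f (PHEndo.proj f ((PHEndo.shift f)^[i] z)) = PHEndo.proj f ((PHEndo.shift f)^[i + 1] z) :=
    fun z i => PHEndo.proj_shift_iterate_add z i 1
  have hone : ∀ j ≤ m, PHEndo.tanNorm E (PHEndo.proj f ((PHEndo.shift f)^[j] x))
      (V (PHEndo.proj f ((PHEndo.shift f)^[j] x)) (PHEndo.proj f ((PHEndo.shift f)^[j] y))) ≤ 1 := by
    intro j hj
    calc _ ≤ L * dist _ _ := (hV _ _ (hd₁ j hj)).2.1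
      _ ≤ L * L⁻¹ := by
        gcongr
        exact ((hd j hj).trans_le (min_le_right _ _)).le
      _ = 1 := mul_inv_cancel₀ hL.ne'
  -- The displacement vectors form an approximate orbit of the derivative cocycle along `x`. Only the
  -- bounds at the two end times are needed.
  have hsmall := hbound _ _ _ _ _ _ (hcoc x) m
    (fun j => V (PHEndo.proj f ((PHEndo.shift f)^[j] x)) (PHEndo.proj f ((PHEndo.shift f)^[j] y)))
    ?_ ?_ (hone 0 (Nat.zero_le m)) (hone m le_rfl)
  · refine hdist m (fun j => PHEndo.proj f ((PHEndo.shift f)^[j] x))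
      (fun j => PHEndo.proj f ((PHEndo.shift f)^[j] y)) fun j hj => ?_
    calc _ ≤ L * _ := (hV _ _ (hd₁ j hj)).1
      _ ≤ L * (B * (ρ ^ j + ρ ^ (m - j))) := by
        gcongr
        exact hsmall j hj
      _ = _ := by ring
  · intro j hj
    rcases Nat.eq_zero_or_pos j with rfl | hj0
    · simp
    · rw [← Real.exp_nat_mul]
      refine Real.exp_le_exp.2 ((hx j hj0 (Nat.le_succ_of_le hj)).le.trans_eq ?_)
      ring
  · intro i hi
    have h := (hV _ _ (hd₁ i hi.le)).2.2
    rw [hmove, hmove] at h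
    exact h (hd₁ (i + 1) hi)
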